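/- Let $k$ be a field, let $A$ and $H$ be Lie algebras over $k$, and let $i_A : A \to U(A)$, $i_H : H \to U(H)$ be the canonical maps into their universal enveloping algebras, which are Hopf algebras in which the elements of $A$ and of $H$ are primitive. Let $(U(A), U(H), \alpha', \beta')$ be a matched pair of bialgebras. This means that $\alpha' : U(H) \otimes U(A) \to U(A)$, written $x \triangleright a$, and $\beta' : U(H) \otimes U(A) \to U(H)$, written $x \triangleleft a$, are coalgebra maps, $\triangleright$ is a left action of the algebra $U(H)$ on $U(A)$, $\triangleleft$ is a right action of the algebra $U(A)$ on $U(H)$, and, for $x, y \in U(H)$ and $a, b \in U(A)$, in Sweedler notation, $$x \triangleright 1 = \varepsilon(x) 1, \qquad 1 \triangleleft a = \varepsilon(a) 1,$$ $$x \triangleright (ab) = \sum (x_{(1)} \triangleright a_{(1)}) \bigl( (x_{(2)} \triangleleft a_{(2)}) \triangleright b \bigr), \qquad (xy) \triangleleft a = \sum \bigl( x \triangleleft (y_{(1)} \triangleright a_{(1)}) \bigr) (y_{(2)} \triangleleft a_{(2)}),$$ $$\sum (x_{(1)} \triangleleft a_{(1)}) \otimes (x_{(2)} \triangleright a_{(2)})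 = \sum (x_{(2)} \triangleleft a_{(2)}) \otimes (x_{(1)} \triangleright a_{(1)}).$$ Assume that $\alpha'(i_H(x) \otimes i_A(a)) \in i_A(A)$ and $\beta'(i_H(x) \otimes i_A(a)) \in i_H(H)$ for all $x \in H$ and $a \in A$. Then there is a unique matched pair of Lie algebras $(A, H, \alpha, \beta)$ such that $i_A(\alpha(x \otimes a)) = \alpha'(i_H(x) \otimes i_A(a))$ and $i_H(\beta(x \otimes a)) = \beta'(i_H(x) \otimes i_A(a))$ for all $x \in H$ and $a \in A$; that is, with $x \triangleright a = \alpha(x \otimes a)$ and $x \triangleleft a = \beta(x \otimes a)$, $A$ is a left $H$-module, $H$ is a right $A$-module, and, for $x, y \in H$ and $a, b \in A$, $$x \triangleright [a, b] = [x \triangleright a, b] + [a, x \triangleright b] + (x \triangleleft a) \triangleright b - (x \triangleleft b) \triangleright a,$$ $$[x, y] \triangleleft a = [x, y \triangleleft a] + [x \triangleleft a, y] + x \triangleleft (y \triangleright a) - y \triangleleft (x \triangleright a).$$ For this matched pair there is an isomorphism of Hopf algebras $$U(A \bowtie H) \cong U(A) \bowtie U(H).$$ Here $A \bowtie H$ is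 the Lie algebra $A \oplus H$ with bracket $[(a, x), (b, y)] = ([a, b] + x \triangleright b - y \triangleright a,\ [x, y] + x \triangleleft b - y \triangleleft a)$, and $U(A) \bowtie U(H)$ is the double cross product, that is, the Hopf algebra $U(A) \otimes U(H)$ with the tensor product coalgebra structure, unit $1 \otimes 1$, multiplication $(a \otimes x)(b \otimes y) = \sum a (x_{(1)} \triangleright b_{(1)}) \otimes (x_{(2)} \triangleleft b_{(2)}) y$ and antipode $S(a \otimes x) = (1 \otimes S(x))(S(a) \otimes 1)$. -/

import Mathlib

open TensorProduct Coalgebra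

noncomputable section

/-! ### The Hopf algebra structure of a universal enveloping algebra -/

namespace UniversalEnvelopingAlgebra

section Hopf

universe u v w

attribute [local instance 100] LieRing.ofAssociativeRing

variable (R : Type u) (L : Type v) [CommRing R] [LieRing L] [LieAlgebra R L]

/-- A Lie algebra morphism into an associative algebra, given as a linear map that sends brackets
to commutators. -/
def lieHomOfCommutator {B : Type w} [Ring B] [Algebra R B] (f : L →ₗ[R] B)
    (hf : ∀ x y, f ⁅x, y⁆ = f x * f y - f y * f x) : L →ₗ⁅R⁆ B :=
  { f with map_lie' := fun {x y} => hf x y }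

theorem ι_lie (x y : L) : ι R ⁅x, y⁆ = ι R x * ι R y - ι R y * ι R x :=
  (ι R).map_lie x y

/-- The comultiplication, determined by `x ↦ x ⊗ 1 + 1 ⊗ x` on `L`. -/
def comulHom : UniversalEnvelopingAlgebra R L →ₐ[R]
    UniversalEnvelopingAlgebra R L ⊗[R] UniversalEnvelopingAlgebra R L :=
  lift R <| lieHomOfCommutator R L
    ((TensorProduct.mk R (UniversalEnvelopingAlgebra R L)
        (UniversalEnvelopingAlgebra R L)).flip 1 ∘ₗ (ι R : L →ₗ⁅R⁆ _).toLinearMap +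
      TensorProduct.mk R (UniversalEnvelopingAlgebra R L)
        (UniversalEnvelopingAlgebra R L) 1 ∘ₗ (ι R : L →ₗ⁅R⁆ _).toLinearMap)
    (fun x y => by
      simp only [LinearMap.add_apply, LinearMap.comp_apply, LieHom.coe_toLinearMap,
        LinearMap.flip_apply, TensorProduct.mk_apply, ι_lie, mul_add, add_mul,
        Algebra.TensorProduct.tmul_mul_tmul, mul_one, one_mul, TensorProduct.sub_tmul,
        TensorProduct.tmul_sub]
      abel)

/-- The counit, which vanishes on `L`. -/
def counitHom : UniversalEnvelopingAlgebra R L →ₐ[R] R :=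
  lift R <| lieHomOfCommutator R L 0 (fun x y => by simp)

/-- The antipode as a morphism to the opposite algebra, determined by `x ↦ -x` on `L`. -/
def antipodeHom : UniversalEnvelopingAlgebra R L →ₐ[R] (UniversalEnvelopingAlgebra R L)ᵐᵒᵖ :=
  lift R <| lieHomOfCommutator R L
    (-((MulOpposite.opLinearEquiv R).toLinearMap ∘ₗ (ι R : L →ₗ⁅R⁆ _).toLinearMap))
    (fun x y => by
      apply MulOpposite.unop_injective
      simp [-ι_apply, LieRing.of_associative_ring_bracket])

variable {L}

theorem comulHom_ι (x : L) : comulHom R L (ι R x) = ι R x ⊗ₜ 1 + 1 ⊗ₜ ι R x :=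
  lift_ι_apply R _ x

theorem counitHom_ι (x : L) : counitHom R L (ι R x) = 0 :=
  lift_ι_apply R _ x

theorem antipodeHom_ι (x : L) : antipodeHom R L (ι R x) = MulOpposite.op (-ι R x) :=
  lift_ι_apply R _ x

theorem algHom_ext_ι {B : Type w} [Ring B] [Algebra R B]
    {f g : UniversalEnvelopingAlgebra R L →ₐ[R] B} (h : ∀ x : L, f (ι R x) = g (ι R x)) : f = g :=
  hom_ext R (LieHom.ext h)

theorem adjoin_ι : Algebra.adjoin R (Set.range (ι R : L →ₗ⁅R⁆ _)) = ⊤ := by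
  set S := Algebra.adjoin R (Set.range (ι R : L →ₗ⁅R⁆ _)) with hS
  let f : UniversalEnvelopingAlgebra R L →ₐ[R] S := lift R <| lieHomOfCommutator R L
    ((ι R : L →ₗ⁅R⁆ _).toLinearMap.codRestrict (Subalgebra.toSubmodule S)
      (fun x => Algebra.subset_adjoin ⟨x, rfl⟩))
    (fun x y => Subtype.ext (ι_lie R L x y))
  have hf : S.val.comp f = AlgHom.id R _ := by
    apply algHom_ext_ι
    intro x
    simp only [AlgHom.comp_apply, f, lift_ι_apply]
    rfl
  rw [eq_top_iff]
  rintro u -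
  have := DFunLike.congr_fun hf u
  simp only [AlgHom.comp_apply, AlgHom.id_apply] at this
  rw [← this]
  exact (f u).2

theorem induction_ι {p : UniversalEnvelopingAlgebra R L → Prop} (one : p 1)
    (add : ∀ u v, p u → p v → p (u + v)) (smul : ∀ (r : R) u, p u → p (r • u))
    (mul : ∀ u (x : L), p u → p (u * ι R x)) (u : UniversalEnvelopingAlgebra R L) : p u := by
  have key : ∀ v ∈ Algebra.adjoin R (Set.range (ι R : L →ₗ⁅R⁆ _)), ∀ u, p u → p (u * v) := by
    intro v hv
    induction hv using Algebra.adjoin_induction with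
    | mem v hv => obtain ⟨x, rfl⟩ := hv; exact fun u hu => mul u x hu
    | algebraMap r => intro u hu; rw [← Algebra.commutes, ← Algebra.smul_def]; exact smul r u hu
    | add v w _ _ hv hw => intro u hu; rw [mul_add]; exact add _ _ (hv u hu) (hw u hu)
    | mul v w _ _ hv hw => intro u hu; rw [← mul_assoc]; exact hw _ (hv u hu)
  simpa using key u (by rw [adjoin_ι]; trivial) 1 one

variable (L)

instance instBialgebra : Bialgebra R (UniversalEnvelopingAlgebra R L) :=
  .ofAlgHom (comulHom R L) (counitHom R L)
    (by
      apply algHom_ext_ι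
      intro x
      simp [-ι_apply, comulHom_ι, Algebra.TensorProduct.one_def, TensorProduct.add_tmul,
        TensorProduct.tmul_add, add_assoc])
    (by apply algHom_ext_ι; intro x; simp [-ι_apply, comulHom_ι, counitHom_ι])
    (by apply algHom_ext_ι; intro x; simp [-ι_apply, comulHom_ι, counitHom_ι])

variable {L}

theorem comul_ι (x : L) :
    comul (R := R) (ι R x) = ι R x ⊗ₜ[R] 1 + 1 ⊗ₜ[R] ι R x :=
  comulHom_ι R x

theorem counit_ι (x : L) : counit (R := R) (ι R x) = 0 :=
  counitHom_ι R x

variable (L)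

instance instHopfAlgebra : HopfAlgebra R (UniversalEnvelopingAlgebra R L) where
  antipode := (MulOpposite.opLinearEquiv R).symm.toLinearMap ∘ₗ (antipodeHom R L).toLinearMap
  mul_antipode_rTensor_comul := by
    ext u
    simp only [LinearMap.comp_apply, Algebra.linearMap_apply]
    induction u using induction_ι with
    | one => simp [Algebra.TensorProduct.one_def]
    | add u v hu hv => simp only [map_add, hu, hv]
    | smul r u hu => rw [map_smul, map_smul, map_smul, map_smul, hu, Algebra.smul_def,
        smul_eq_mul, map_mul]
    | mul u x hu =>
      have key : ∀ z : UniversalEnvelopingAlgebra R L ⊗[R] UniversalEnvelopingAlgebra R L,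
          LinearMap.mul' R _ (((MulOpposite.opLinearEquiv R).symm.toLinearMap ∘ₗ
            (antipodeHom R L).toLinearMap).rTensor _ (z * (ι R x ⊗ₜ 1 + 1 ⊗ₜ ι R x))) =
          LinearMap.mul' R _ (((MulOpposite.opLinearEquiv R).symm.toLinearMap ∘ₗ
            (antipodeHom R L).toLinearMap).rTensor _ z) * ι R x -
          ι R x * LinearMap.mul' R _ (((MulOpposite.opLinearEquiv R).symm.toLinearMap ∘ₗ
            (antipodeHom R L).toLinearMap).rTensor _ z) := by
        intro z
        induction z with
        | zero => simp
        | add z w hz hw => rw [add_mul, map_add, map_add, hz, hw, map_add, map_add, add_mul, mul_add]; abel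
        | tmul a b => simp [-ι_apply, mul_add, antipodeHom_ι, mul_assoc]; abel
      rw [Bialgebra.comul_mul, comul_ι, key, hu, Bialgebra.counit_mul, counit_ι, mul_zero,
        map_zero, Algebra.commutes, sub_self]
  mul_antipode_lTensor_comul := by
    ext u
    simp only [LinearMap.comp_apply, Algebra.linearMap_apply]
    induction u using induction_ι with
    | one => simp [Algebra.TensorProduct.one_def]
    | add u v hu hv => simp only [map_add, hu, hv]
    | smul r u hu => rw [map_smul, map_smul, map_smul, map_smul, hu, Algebra.smul_def,
        smul_eq_mul, map_mul]
    | mul u x hu =>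
      have key : ∀ z : UniversalEnvelopingAlgebra R L ⊗[R] UniversalEnvelopingAlgebra R L,
          LinearMap.mul' R _ (((MulOpposite.opLinearEquiv R).symm.toLinearMap ∘ₗ
            (antipodeHom R L).toLinearMap).lTensor _ (z * (ι R x ⊗ₜ 1 + 1 ⊗ₜ ι R x))) = 0 := by
        intro z
        induction z with
        | zero => simp
        | add z w hz hw => rw [add_mul, map_add, map_add, hz, hw, add_zero]
        | tmul a b => simp [-ι_apply, mul_add, antipodeHom_ι, mul_assoc]
      rw [Bialgebra.comul_mul, comul_ι, key, Bialgebra.counit_mul, counit_ι, mul_zero, map_zero]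

theorem antipode_ι (x : L) : HopfAlgebra.antipode R (ι R x) = -ι R x := by
  change MulOpposite.unop (antipodeHom R L (ι R x)) = _
  rw [antipodeHom_ι, MulOpposite.unop_op]

end Hopf

end UniversalEnvelopingAlgebra

/-! ### Matched pairs of Lie algebras and the double cross sum -/

/-- A matched pair `(A, H, α, β)` of Lie algebras: `α x a = x ▷ a` is a left action of `H` on `A`,
`β x a = x ◁ a` is a right action of `A` on `H`, and the two are compatible with the brackets. -/
@[ext]
structure LieMatchedPair (R A H : Type*) [CommRing R] [LieRing A] [LieAlgebra R A] [LieRing H]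
    [LieAlgebra R H] where
  /-- The left action `x ▷ a` of `H` on `A`. -/
  α : H →ₗ[R] A →ₗ[R] A
  /-- The right action `x ◁ a` of `A` on `H`. -/
  β : H →ₗ[R] A →ₗ[R] H
  lie_α : ∀ x y a, α ⁅x, y⁆ a = α x (α y a) - α y (α x a)
  β_lie : ∀ x a b, β x ⁅a, b⁆ = β (β x a) b - β (β x b) a
  α_lie : ∀ x a b, α x ⁅a, b⁆ = ⁅α x a, b⁆ + ⁅a, α x b⁆ + α (β x a) b - α (β x b) a
  lie_β : ∀ x y a, β ⁅x, y⁆ a = ⁅x, β y a⁆ + ⁅β x a, y⁆ + β x (α y a) - β y (α x a)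

namespace LieMatchedPair

variable {R A H : Type*} [CommRing R] [LieRing A] [LieAlgebra R A] [LieRing H] [LieAlgebra R H]

/-- The double cross sum `A ⋈ H` of a matched pair of Lie algebras: the module `A ⊕ H` with bracket
`[(a, x), (b, y)] = ([a, b] + x ▷ b - y ▷ a, [x, y] + x ◁ b - y ◁ a)`. -/
def DoubleCrossSum (_M : LieMatchedPair R A H) : Type _ := A × H

variable (M : LieMatchedPair R A H)

instance : AddCommGroup M.DoubleCrossSum := inferInstanceAs (AddCommGroup (A × H))

instance : Module R M.DoubleCrossSum := inferInstanceAs (Module R (A × H))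

instance : LieRing M.DoubleCrossSum where
  bracket p q :=
    ((⁅p.1, q.1⁆ + M.α p.2 q.1 - M.α q.2 p.1, ⁅p.2, q.2⁆ + M.β p.2 q.1 - M.β q.2 p.1) : A × H)
  add_lie p q r := by
    apply Prod.ext
    · change ⁅p.1 + q.1, r.1⁆ + M.α (p.2 + q.2) r.1 - M.α r.2 (p.1 + q.1) =
        (⁅p.1, r.1⁆ + M.α p.2 r.1 - M.α r.2 p.1) + (⁅q.1, r.1⁆ + M.α q.2 r.1 - M.α r.2 q.1)
      simp only [add_lie, map_add, LinearMap.add_apply]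
      abel
    · change ⁅p.2 + q.2, r.2⁆ + M.β (p.2 + q.2) r.1 - M.β r.2 (p.1 + q.1) =
        (⁅p.2, r.2⁆ + M.β p.2 r.1 - M.β r.2 p.1) + (⁅q.2, r.2⁆ + M.β q.2 r.1 - M.β r.2 q.1)
      simp only [add_lie, map_add, LinearMap.add_apply]
      abel
  lie_add p q r := by
    apply Prod.ext
    · change ⁅p.1, q.1 + r.1⁆ + M.α p.2 (q.1 + r.1) - M.α (q.2 + r.2) p.1 =
        (⁅p.1, q.1⁆ + M.α p.2 q.1 - M.α q.2 p.1) + (⁅p.1, r.1⁆ + M.α p.2 r.1 - M.α r.2 p.1)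
      simp only [lie_add, map_add, LinearMap.add_apply]
      abel
    · change ⁅p.2, q.2 + r.2⁆ + M.β p.2 (q.1 + r.1) - M.β (q.2 + r.2) p.1 =
        (⁅p.2, q.2⁆ + M.β p.2 q.1 - M.β q.2 p.1) + (⁅p.2, r.2⁆ + M.β p.2 r.1 - M.β r.2 p.1)
      simp only [lie_add, map_add, LinearMap.add_apply]
      abel
  lie_self p := by
    apply Prod.ext
    · change ⁅p.1, p.1⁆ + M.α p.2 p.1 - M.α p.2 p.1 = 0
      simp
    · change ⁅p.2, p.2⁆ + M.β p.2 p.1 - M.β p.2 p.1 = 0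
      simp
  leibniz_lie p q r := by
    obtain ⟨a, x⟩ := p
    obtain ⟨b, y⟩ := q
    obtain ⟨c, z⟩ := r
    apply Prod.ext
    · change ⁅a, ⁅b, c⁆ + M.α y c - M.α z b⁆ + M.α x (⁅b, c⁆ + M.α y c - M.α z b) -
          M.α (⁅y, z⁆ + M.β y c - M.β z b) a =
        (⁅⁅a, b⁆ + M.α x b - M.α y a, c⁆ + M.α (⁅x, y⁆ + M.β x b - M.β y a) c -
          M.α z (⁅a, b⁆ + M.α x b - M.α y a)) +
        (⁅b, ⁅a, c⁆ + M.α x c - M.α z a⁆ + M.α y (⁅a, c⁆ + M.α x c - M.α z a) -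
          M.α (⁅x, z⁆ + M.β x c - M.β z a) b)
      simp only [lie_add, add_lie, lie_sub, sub_lie, map_add, map_sub, LinearMap.add_apply,
        LinearMap.sub_apply, M.lie_α, M.α_lie, leibniz_lie a b c]
      rw [← lie_skew (M.α y a) c, ← lie_skew (M.α z a) b]
      abel
    · change ⁅x, ⁅y, z⁆ + M.β y c - M.β z b⁆ + M.β x (⁅b, c⁆ + M.α y c - M.α z b) -
          M.β (⁅y, z⁆ + M.β y c - M.β z b) a =
        (⁅⁅x, y⁆ + M.β x b - M.β y a, z⁆ + M.β (⁅x, y⁆ + M.β x b - M.β y a) c -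
          M.β z (⁅a, b⁆ + M.α x b - M.α y a)) +
        (⁅y, ⁅x, z⁆ + M.β x c - M.β z a⁆ + M.β y (⁅a, c⁆ + M.α x c - M.α z a) -
          M.β (⁅x, z⁆ + M.β x c - M.β z a) b)
      simp only [lie_add, add_lie, lie_sub, sub_lie, map_add, map_sub, LinearMap.add_apply,
        LinearMap.sub_apply, M.lie_β, M.β_lie, leibniz_lie x y z]
      rw [← lie_skew (M.β x c) y]
      abel

instance : LieAlgebra R M.DoubleCrossSum where
  lie_smul r p q := by
    apply Prod.ext
    · change ⁅p.1, r • q.1⁆ + M.α p.2 (r • q.1) - M.α (r • q.2) p.1 =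
        r • (⁅p.1, q.1⁆ + M.α p.2 q.1 - M.α q.2 p.1)
      simp only [lie_smul, map_smul, LinearMap.smul_apply, smul_add, smul_sub]
    · change ⁅p.2, r • q.2⁆ + M.β p.2 (r • q.1) - M.β (r • q.2) p.1 =
        r • (⁅p.2, q.2⁆ + M.β p.2 q.1 - M.β q.2 p.1)
      simp only [lie_smul, map_smul, LinearMap.smul_apply, smul_add, smul_sub]

end LieMatchedPair

/-! ### Matched pairs of bialgebras and the double cross product -/

section Cross

variable {R A H : Type*} [CommRing R] [Ring A] [Ring H] [Bialgebra R A] [Bialgebra R H]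

/-- The map `x ⊗ a ↦ ∑ α (x₁ ⊗ a₁) ⊗ β (x₂ ⊗ a₂)`, in Sweedler notation. -/
def crossMap (α : H ⊗[R] A →ₗ[R] A) (β : H ⊗[R] A →ₗ[R] H) : H ⊗[R] A →ₗ[R] A ⊗[R] H :=
  TensorProduct.map α β ∘ₗ comul

end Cross

/-- A matched pair `(A, H, α, β)` of bialgebras. Writing `x ▷ a = α (x ⊗ a)` and
`x ◁ a = β (x ⊗ a)`, the algebra `A` is a left `H`-module coalgebra, `H` is a right `A`-module
coalgebra, and the two actions are compatible. -/
structure BialgebraMatchedPair (R A H : Type*) [CommRing R] [Ring A] [Ring H] [Bialgebra R A]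
    [Bialgebra R H] where
  /-- The left action `x ▷ a` of `H` on `A`, a morphism of coalgebras. -/
  α : H ⊗[R] A →ₗc[R] A
  /-- The right action `x ◁ a` of `A` on `H`, a morphism of coalgebras. -/
  β : H ⊗[R] A →ₗc[R] H
  /-- `1 ▷ a = a` -/
  one_α : ∀ a, α (1 ⊗ₜ a) = a
  /-- `(x y) ▷ a = x ▷ (y ▷ a)` -/
  mul_α : ∀ x y a, α ((x * y) ⊗ₜ a) = α (x ⊗ₜ α (y ⊗ₜ a))
  /-- `x ◁ 1 = x` -/
  β_one : ∀ x, β (x ⊗ₜ 1) = x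
  /-- `x ◁ (a b) = (x ◁ a) ◁ b` -/
  β_mul : ∀ x a b, β (x ⊗ₜ (a * b)) = β (β (x ⊗ₜ a) ⊗ₜ b)
  /-- `x ▷ 1 = ε(x) 1` -/
  α_one : ∀ x, α (x ⊗ₜ 1) = counit (R := R) x • 1
  /-- `1 ◁ a = ε(a) 1` -/
  one_β : ∀ a, β (1 ⊗ₜ a) = counit (R := R) a • 1
  /-- `x ▷ (a b) = ∑ (x₁ ▷ a₁) ((x₂ ◁ a₂) ▷ b)` -/
  α_mul : ∀ x a b, α (x ⊗ₜ (a * b)) = LinearMap.mul' R A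
    (((α : H ⊗[R] A →ₗ[R] A) ∘ₗ (TensorProduct.mk R H A).flip b).lTensor A
      (crossMap (α : H ⊗[R] A →ₗ[R] A) (β : H ⊗[R] A →ₗ[R] H) (x ⊗ₜ a)))
  /-- `(x y) ◁ a = ∑ (x ◁ (y₁ ▷ a₁)) (y₂ ◁ a₂)` -/
  mul_β : ∀ x y a, β ((x * y) ⊗ₜ a) = LinearMap.mul' R H
    (((β : H ⊗[R] A →ₗ[R] H) ∘ₗ TensorProduct.mk R H A x).rTensor H
      (crossMap (α : H ⊗[R] A →ₗ[R] A) (β : H ⊗[R] A →ₗ[R] H) (y ⊗ₜ a)))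
  /-- `∑ (x₁ ◁ a₁) ⊗ (x₂ ▷ a₂) = ∑ (x₂ ◁ a₂) ⊗ (x₁ ▷ a₁)` -/
  cross_comm : ∀ x a,
    TensorProduct.map (β : H ⊗[R] A →ₗ[R] H) (α : H ⊗[R] A →ₗ[R] A) (comul (x ⊗ₜ[R] a)) =
      TensorProduct.comm R A H
        (crossMap (α : H ⊗[R] A →ₗ[R] A) (β : H ⊗[R] A →ₗ[R] H) (x ⊗ₜ a))

namespace BialgebraMatchedPair

variable {R A H : Type*} [CommRing R] [Ring A] [Ring H]

section Bialgebra

variable [Bialgebra R A] [Bialgebra R H] (P : BialgebraMatchedPair R A H)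

/-- The left action as a linear map. -/
abbrev αₗ : H ⊗[R] A →ₗ[R] A := (P.α : H ⊗[R] A →ₗ[R] A)

/-- The right action as a linear map. -/
abbrev βₗ : H ⊗[R] A →ₗ[R] H := (P.β : H ⊗[R] A →ₗ[R] H)

/-- The map `x ⊗ a ↦ ∑ (x₁ ▷ a₁) ⊗ (x₂ ◁ a₂)`. -/
abbrev cross : H ⊗[R] A →ₗ[R] A ⊗[R] H := crossMap P.αₗ P.βₗ

theorem cross_apply (c : H ⊗[R] A) : P.cross c = TensorProduct.map P.αₗ P.βₗ (comul c) := rfl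

variable (R A H) in
/-- The map `(a, y) ↦ (p ⊗ h ↦ a p ⊗ h y)`. -/
def sandwich : A →ₗ[R] H →ₗ[R] A ⊗[R] H →ₗ[R] A ⊗[R] H :=
  (TensorProduct.mapBilinear (RingHom.id R) A H A H).compl₁₂ (LinearMap.mul R A)
    (LinearMap.mul R H).flip

theorem sandwich_tmul (a p : A) (h y : H) :
    sandwich R A H a y (p ⊗ₜ h) = (a * p) ⊗ₜ (h * y) := rfl

/-- The multiplication `(a ⊗ x) (b ⊗ y) = ∑ a (x₁ ▷ b₁) ⊗ (x₂ ◁ b₂) y` of the double cross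
product. -/
def mulAux : A ⊗[R] H →ₗ[R] A ⊗[R] H →ₗ[R] A ⊗[R] H :=
  TensorProduct.lift <| LinearMap.mk₂ R
    (fun a x => TensorProduct.lift
      ((sandwich R A H a).flip ∘ₗ P.cross ∘ₗ TensorProduct.mk R H A x))
    (fun a a' x => by ext; simp) (fun r a x => by ext; simp)
    (fun a x x' => by ext; simp)
    (fun r a x => by ext; simp)

theorem mulAux_tmul (a b : A) (x y : H) :
    P.mulAux (a ⊗ₜ x) (b ⊗ₜ y) = sandwich R A H a y (P.cross (x ⊗ₜ b)) := rfl

theorem sandwich_sandwich (a a' : A) (y y' : H) (t : A ⊗[R] H) :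
    sandwich R A H a y (sandwich R A H a' y' t) = sandwich R A H (a * a') (y' * y) t := by
  induction t with
  | zero => simp
  | add s t hs ht => simp only [map_add, hs, ht]
  | tmul p h => simp only [sandwich_tmul, mul_assoc]

theorem mulAux_sandwich_left (a : A) (t u : A ⊗[R] H) :
    P.mulAux (sandwich R A H a 1 t) u = sandwich R A H a 1 (P.mulAux t u) := by
  induction t with
  | zero => simp
  | add s t hs ht => simp only [map_add, LinearMap.add_apply, hs, ht]
  | tmul p h =>
    induction u with
    | zero => simp
    | add s t hs ht => simp only [map_add, hs, ht]
    | tmul q g => simp only [sandwich_tmul, mulAux_tmul, sandwich_sandwich, mul_one]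

theorem mulAux_sandwich_right (y : H) (t u : A ⊗[R] H) :
    P.mulAux t (sandwich R A H 1 y u) = sandwich R A H 1 y (P.mulAux t u) := by
  induction u with
  | zero => simp
  | add s t hs ht => simp only [map_add, hs, ht]
  | tmul p h =>
    induction t with
    | zero => simp
    | add s t hs ht => simp only [map_add, LinearMap.add_apply, hs, ht]
    | tmul q g => simp only [sandwich_tmul, mulAux_tmul, sandwich_sandwich, one_mul]

theorem comul_α (c : H ⊗[R] A) : comul (R := R) (P.α c) =
    TensorProduct.map P.αₗ P.αₗ (comul c) :=
  (CoalgHomClass.map_comp_comul_apply P.α c).symm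

theorem comul_β (c : H ⊗[R] A) : comul (R := R) (P.β c) =
    TensorProduct.map P.βₗ P.βₗ (comul c) :=
  (CoalgHomClass.map_comp_comul_apply P.β c).symm

theorem cross_mul (x : H) (a b : A) :
    P.cross (x ⊗ₜ (a * b)) = P.mulAux (P.cross (x ⊗ₜ a)) (b ⊗ₜ 1) := by
  set r := ℛ R b
  let G : A × A → A ⊗[R] (H ⊗[R] H) →ₗ[R] A ⊗[R] H := fun i =>
    TensorProduct.map (LinearMap.mul' R A ∘ₗ
        (P.αₗ ∘ₗ (TensorProduct.mk R H A).flip (r.left i)).lTensor A)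
      (P.βₗ ∘ₗ (TensorProduct.mk R H A).flip (r.right i)) ∘ₗ
      (TensorProduct.assoc R A H H).symm.toLinearMap
  have h1 : ∀ t : A ⊗[R] H, P.mulAux t (b ⊗ₜ 1) =
      ∑ i ∈ r.index, G i (comul.lTensor A t) := by
    intro t
    induction t with
    | zero => simp
    | add s t hs ht => simp only [map_add, LinearMap.add_apply, hs, ht, Finset.sum_add_distrib]
    | tmul p h =>
      rw [mulAux_tmul, cross_apply, comul_tmul, ← r.eq, LinearMap.lTensor_tmul]
      generalize (comul h : H ⊗[R] H) = z
      induction z with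
      | zero => simp
      | add s t hs ht =>
        simp only [map_add, TensorProduct.add_tmul, TensorProduct.tmul_add, hs, ht,
          Finset.sum_add_distrib]
      | tmul h k =>
        simp [G, TensorProduct.tmul_sum, sandwich_tmul]
  have h2 : ∀ c : H ⊗[R] A, comul.lTensor A (P.cross c) =
      TensorProduct.map P.αₗ (TensorProduct.map P.βₗ P.βₗ) (comul.lTensor _ (comul c)) := by
    intro c
    rw [cross_apply]
    generalize (comul c : (H ⊗[R] A) ⊗[R] (H ⊗[R] A)) = z
    induction z with
    | zero => simp
    | add s t hs ht => simp only [map_add, hs, ht]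
    | tmul c d => simp only [TensorProduct.map_tmul, LinearMap.lTensor_tmul,
        LinearMap.coe_coe, comul_β]
  have h3 : P.cross (x ⊗ₜ (a * b)) = ∑ i ∈ r.index,
      TensorProduct.map (LinearMap.mul' R A ∘ₗ
        (P.αₗ ∘ₗ (TensorProduct.mk R H A).flip (r.left i)).lTensor A ∘ₗ P.cross)
        (P.βₗ ∘ₗ (TensorProduct.mk R H A).flip (r.right i) ∘ₗ P.βₗ) (comul (x ⊗ₜ[R] a)) := by
    rw [cross_apply, comul_tmul, comul_tmul, Bialgebra.comul_mul, ← r.eq]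
    generalize (comul x : H ⊗[R] H) = X
    generalize (comul a : A ⊗[R] A) = Y
    induction X with
    | zero => simp
    | add s t hs ht =>
      simp only [map_add, TensorProduct.add_tmul, hs, ht, Finset.sum_add_distrib]
    | tmul x₁ x₂ =>
      induction Y with
      | zero => simp
      | add s t hs ht =>
        simp only [map_add, add_mul, TensorProduct.tmul_add, hs, ht, Finset.sum_add_distrib]
      | tmul a₁ a₂ =>
        simp [Finset.mul_sum, TensorProduct.tmul_sum, P.α_mul, P.β_mul]
  rw [h1, h3]
  refine Finset.sum_congr rfl fun i _ => ?_
  rw [h2, ← coassoc_apply]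
  generalize (comul (x ⊗ₜ[R] a) : (H ⊗[R] A) ⊗[R] (H ⊗[R] A)) = z
  induction z with
  | zero => simp
  | add s t hs ht => simp only [map_add, hs, ht]
  | tmul c d =>
    rw [TensorProduct.map_tmul, LinearMap.rTensor_tmul]
    simp only [LinearMap.comp_apply, cross_apply]
    generalize (comul c : (H ⊗[R] A) ⊗[R] (H ⊗[R] A)) = z
    induction z with
    | zero => simp
    | add s t hs ht => simp only [map_add, TensorProduct.add_tmul, hs, ht]
    | tmul c e => simp [G]

theorem mul_cross (x y : H) (b : A) :
    P.cross ((x * y) ⊗ₜ b) = P.mulAux (1 ⊗ₜ x) (P.cross (y ⊗ₜ b)) := by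
  set r := ℛ R x
  let G : H × H → (A ⊗[R] A) ⊗[R] H →ₗ[R] A ⊗[R] H := fun i =>
    TensorProduct.map (P.αₗ ∘ₗ TensorProduct.mk R H A (r.left i))
      (LinearMap.mul' R H ∘ₗ (P.βₗ ∘ₗ TensorProduct.mk R H A (r.right i)).rTensor H) ∘ₗ
      (TensorProduct.assoc R A A H).toLinearMap
  have h1 : ∀ t : A ⊗[R] H, P.mulAux (1 ⊗ₜ x) t =
      ∑ i ∈ r.index, G i (comul.rTensor H t) := by
    intro t
    induction t with
    | zero => simp
    | add s t hs ht => simp only [map_add, hs, ht, Finset.sum_add_distrib]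
    | tmul p h =>
      rw [mulAux_tmul, cross_apply, comul_tmul, ← r.eq, LinearMap.rTensor_tmul]
      generalize (comul p : A ⊗[R] A) = z
      induction z with
      | zero => simp
      | add s t hs ht =>
        simp only [map_add, TensorProduct.add_tmul, TensorProduct.tmul_add, hs, ht,
          Finset.sum_add_distrib]
      | tmul p q =>
        simp [G, TensorProduct.sum_tmul, sandwich_tmul]
  have h2 : ∀ c : H ⊗[R] A, comul.rTensor H (P.cross c) =
      TensorProduct.map (TensorProduct.map P.αₗ P.αₗ) P.βₗ (comul.rTensor _ (comul c)) := by
    intro c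
    rw [cross_apply]
    generalize (comul c : (H ⊗[R] A) ⊗[R] (H ⊗[R] A)) = z
    induction z with
    | zero => simp
    | add s t hs ht => simp only [map_add, hs, ht]
    | tmul c d => simp only [TensorProduct.map_tmul, LinearMap.rTensor_tmul,
        LinearMap.coe_coe, comul_α]
  have h3 : P.cross ((x * y) ⊗ₜ b) = ∑ i ∈ r.index,
      TensorProduct.map (P.αₗ ∘ₗ TensorProduct.mk R H A (r.left i) ∘ₗ P.αₗ)
        (LinearMap.mul' R H ∘ₗ
          (P.βₗ ∘ₗ TensorProduct.mk R H A (r.right i)).rTensor H ∘ₗ P.cross)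
        (comul (y ⊗ₜ[R] b)) := by
    rw [cross_apply, comul_tmul, comul_tmul, Bialgebra.comul_mul, ← r.eq]
    generalize (comul y : H ⊗[R] H) = X
    generalize (comul b : A ⊗[R] A) = Y
    induction X with
    | zero => simp
    | add s t hs ht =>
      simp only [map_add, mul_add, TensorProduct.add_tmul, hs, ht, Finset.sum_add_distrib]
    | tmul x₁ x₂ =>
      induction Y with
      | zero => simp
      | add s t hs ht =>
        simp only [map_add, TensorProduct.tmul_add, hs, ht, Finset.sum_add_distrib]
      | tmul a₁ a₂ =>
        simp [Finset.sum_mul, TensorProduct.sum_tmul, P.mul_α, P.mul_β]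
  rw [h1, h3]
  refine Finset.sum_congr rfl fun i _ => ?_
  rw [h2, ← coassoc_symm_apply]
  generalize (comul (y ⊗ₜ[R] b) : (H ⊗[R] A) ⊗[R] (H ⊗[R] A)) = z
  induction z with
  | zero => simp
  | add s t hs ht => simp only [map_add, hs, ht]
  | tmul c d =>
    rw [TensorProduct.map_tmul, LinearMap.lTensor_tmul]
    simp only [LinearMap.comp_apply, cross_apply]
    generalize (comul d : (H ⊗[R] A) ⊗[R] (H ⊗[R] A)) = z
    induction z with
    | zero => simp
    | add s t hs ht => simp only [map_add, TensorProduct.tmul_add, hs, ht]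
    | tmul d e => simp [G]

theorem cross_one (x : H) : P.cross (x ⊗ₜ 1) = 1 ⊗ₜ x := by
  set r := ℛ R x
  rw [cross_apply, comul_tmul, ← r.eq, Bialgebra.comul_one, Algebra.TensorProduct.one_def]
  simp only [TensorProduct.sum_tmul, map_sum]
  conv_rhs => rw [← sum_counit_smul r, TensorProduct.tmul_sum]
  refine Finset.sum_congr rfl fun i _ => ?_
  simp [P.α_one, P.β_one, TensorProduct.smul_tmul]

theorem one_cross (a : A) : P.cross (1 ⊗ₜ a) = a ⊗ₜ 1 := by
  set r := ℛ R a
  have h : ∑ i ∈ r.index, counit (R := R) (r.right i) • r.left i = a := by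
    have := congr(TensorProduct.rid R A $(sum_tmul_counit_eq r))
    simpa only [map_sum, TensorProduct.rid_tmul, one_smul] using this
  rw [cross_apply, comul_tmul, ← r.eq, Bialgebra.comul_one, Algebra.TensorProduct.one_def]
  simp only [TensorProduct.tmul_sum, map_sum]
  conv_rhs => rw [← h, TensorProduct.sum_tmul]
  refine Finset.sum_congr rfl fun i _ => ?_
  simp [P.one_α, P.one_β, TensorProduct.smul_tmul]

theorem one_sandwich (t : A ⊗[R] H) : sandwich R A H 1 1 t = t := by
  induction t with
  | zero => simp
  | add s t hs ht => simp only [map_add, hs, ht]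
  | tmul p h => simp only [sandwich_tmul, one_mul, mul_one]

theorem mulAux_one (t : A ⊗[R] H) : P.mulAux t (1 ⊗ₜ 1) = t := by
  induction t with
  | zero => simp
  | add s t hs ht => simp only [map_add, LinearMap.add_apply, hs, ht]
  | tmul p h => rw [mulAux_tmul, cross_one, sandwich_tmul, mul_one, mul_one]

theorem one_mulAux (t : A ⊗[R] H) : P.mulAux (1 ⊗ₜ 1) t = t := by
  induction t with
  | zero => simp
  | add s t hs ht => simp only [map_add, hs, ht]
  | tmul p h => rw [mulAux_tmul, one_cross, sandwich_tmul, one_mul, one_mul]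

theorem mulAux_assoc (t u v : A ⊗[R] H) :
    P.mulAux (P.mulAux t u) v = P.mulAux t (P.mulAux u v) := by
  have h1 : ∀ (t : A ⊗[R] H) (y : H) (c : A),
      P.mulAux (sandwich R A H 1 y t) (c ⊗ₜ 1) = P.mulAux t (P.cross (y ⊗ₜ c)) := by
    intro t y c
    induction t with
    | zero => simp
    | add s t hs ht => simp only [map_add, LinearMap.add_apply, hs, ht]
    | tmul p h =>
      have e : (p ⊗ₜ[R] h : A ⊗[R] H) = sandwich R A H p 1 (1 ⊗ₜ h) := by
        simp only [sandwich_tmul, mul_one]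
      rw [sandwich_tmul, mulAux_tmul, mul_cross, e, mulAux_sandwich_left, one_mul]
  have h2 : ∀ (x : H) (b : A) (u : A ⊗[R] H),
      P.mulAux (1 ⊗ₜ x) (sandwich R A H b 1 u) = P.mulAux (P.cross (x ⊗ₜ b)) u := by
    intro x b u
    induction u with
    | zero => simp
    | add s t hs ht => simp only [map_add, hs, ht]
    | tmul q g =>
      have e : (q ⊗ₜ[R] g : A ⊗[R] H) = sandwich R A H 1 g (q ⊗ₜ 1) := by
        simp only [sandwich_tmul, one_mul]
      rw [sandwich_tmul, mulAux_tmul, cross_mul, e, mulAux_sandwich_right, mul_one]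
  induction t with
  | zero => simp
  | add s t hs ht => simp only [map_add, LinearMap.add_apply, hs, ht]
  | tmul a x =>
    induction u with
    | zero => simp
    | add s t hs ht => simp only [map_add, LinearMap.add_apply, hs, ht]
    | tmul b y =>
      induction v with
      | zero => simp
      | add s t hs ht => simp only [map_add, hs, ht]
      | tmul c z =>
        have e1 : sandwich R A H a y (P.cross (x ⊗ₜ b)) =
            sandwich R A H a 1 (sandwich R A H 1 y (P.cross (x ⊗ₜ b))) := by
          rw [sandwich_sandwich, mul_one, mul_one]
        have e2 : sandwich R A H b z (P.cross (y ⊗ₜ c)) =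
            sandwich R A H 1 z (sandwich R A H b 1 (P.cross (y ⊗ₜ c))) := by
          rw [sandwich_sandwich, one_mul, one_mul]
        have e3 : (c ⊗ₜ[R] z : A ⊗[R] H) = sandwich R A H 1 z (c ⊗ₜ 1) := by
          simp only [sandwich_tmul, one_mul]
        have e4 : (a ⊗ₜ[R] x : A ⊗[R] H) = sandwich R A H a 1 (1 ⊗ₜ x) := by
          simp only [sandwich_tmul, mul_one]
        rw [mulAux_tmul, mulAux_tmul, e1, e2, e3, e4, mulAux_sandwich_left,
          mulAux_sandwich_left, mulAux_sandwich_right, mulAux_sandwich_right, h1, h2]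

theorem counit_cross (c : H ⊗[R] A) : counit (R := R) (P.cross c) = counit (R := R) c := by
  set r := ℛ R c
  rw [cross_apply, ← r.eq]
  conv_rhs => rw [← sum_counit_smul r]
  simp only [map_sum]
  refine Finset.sum_congr rfl fun i _ => ?_
  have h1 : counit (R := R) (P.α (r.left i)) = counit (R := R) (r.left i) :=
    CoalgHomClass.counit_comp_apply P.α _
  have h2 : counit (R := R) (P.β (r.right i)) = counit (R := R) (r.right i) :=
    CoalgHomClass.counit_comp_apply P.β _
  simp [h1, h2, mul_comm]

theorem counit_mulAux (t u : A ⊗[R] H) :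
    counit (R := R) (P.mulAux t u) = counit (R := R) t * counit (R := R) u := by
  have h : ∀ (a : A) (y : H) (t : A ⊗[R] H), counit (R := R) (sandwich R A H a y t) =
      counit (R := R) a * counit (R := R) y * counit (R := R) t := by
    intro a y t
    induction t with
    | zero => simp
    | add s t hs ht => simp only [map_add, hs, ht, mul_add]
    | tmul p h => simp [sandwich_tmul]; ring
  induction t with
  | zero => simp
  | add s t hs ht => simp only [map_add, LinearMap.add_apply, hs, ht, add_mul]
  | tmul a x =>
    induction u with
    | zero => simp
    | add s t hs ht => simp only [map_add, hs, ht, mul_add]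
    | tmul b y =>
      rw [mulAux_tmul, h, counit_cross]
      simp
      ring

theorem comul_cross (c : H ⊗[R] A) :
    comul (R := R) (P.cross c) = TensorProduct.map P.cross P.cross (comul c) := by
  have hc : ∀ d : H ⊗[R] A, TensorProduct.map P.βₗ P.αₗ (comul d) =
      TensorProduct.comm R A H (P.cross d) := by
    intro d
    induction d with
    | zero => simp
    | add s t hs ht => simp only [map_add, hs, ht]
    | tmul x a => exact P.cross_comm x a
  have key : TensorProduct.map (comul (R := R)) (comul (R := R)) (comul c) =
      (TensorProduct.assoc R (H ⊗[R] A) (H ⊗[R] A) ((H ⊗[R] A) ⊗[R] (H ⊗[R] A))).symm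
        (((TensorProduct.assoc R (H ⊗[R] A) (H ⊗[R] A) (H ⊗[R] A)).toLinearMap ∘ₗ
          comul.rTensor _ ∘ₗ comul).lTensor _ (comul c)) := by
    have h : ∀ w : (H ⊗[R] A) ⊗[R] ((H ⊗[R] A) ⊗[R] (H ⊗[R] A)),
        (comul (R := R)).lTensor _ ((TensorProduct.assoc R _ _ _).symm w) =
          (TensorProduct.assoc R (H ⊗[R] A) (H ⊗[R] A) ((H ⊗[R] A) ⊗[R] (H ⊗[R] A))).symm
            (((comul (R := R)).lTensor (H ⊗[R] A)).lTensor _ w) := by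
      intro w
      induction w with
      | zero => simp only [map_zero]
      | add s t hs ht => simp only [map_add, hs, ht]
      | tmul c w =>
        induction w with
        | zero => simp only [map_zero, TensorProduct.tmul_zero]
        | add s t hs ht => simp only [map_add, TensorProduct.tmul_add, hs, ht]
        | tmul d e => rfl
    rw [coassoc, LinearMap.lTensor_comp, LinearMap.comp_apply, ← h, coassoc_symm_apply]
    exact (LinearMap.congr_fun (LinearMap.lTensor_comp_rTensor _ _ _) _).symm
  have h1 : comul (R := R) (P.cross c) =
      TensorProduct.AlgebraTensorModule.tensorTensorTensorComm R R R R A A H H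
        (TensorProduct.map (TensorProduct.map P.αₗ P.αₗ) (TensorProduct.map P.βₗ P.βₗ)
          (TensorProduct.map (comul (R := R)) (comul (R := R)) (comul c))) := by
    rw [cross_apply]
    generalize (comul c : (H ⊗[R] A) ⊗[R] (H ⊗[R] A)) = z
    induction z with
    | zero => simp only [map_zero]
    | add s t hs ht => simp only [map_add, hs, ht]
    | tmul c d => simp only [TensorProduct.map_tmul, comul_tmul, LinearMap.coe_coe, comul_α,
        comul_β]
  have h2 : TensorProduct.map P.cross P.cross (comul c) =
      TensorProduct.map (TensorProduct.map P.αₗ P.βₗ) (TensorProduct.map P.αₗ P.βₗ)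
          (TensorProduct.map (comul (R := R)) (comul (R := R)) (comul c)) := by
    rw [← LinearMap.comp_apply (TensorProduct.map _ _) (TensorProduct.map _ _),
      ← TensorProduct.map_comp]
    rfl
  rw [h1, h2, key]
  generalize (comul c : (H ⊗[R] A) ⊗[R] (H ⊗[R] A)) = z
  induction z with
  | zero => simp only [map_zero]
  | add s t hs ht => simp only [map_add, hs, ht]
  | tmul c d =>
    rw [LinearMap.lTensor_tmul, LinearMap.comp_apply, LinearMap.comp_apply]
    generalize (comul d : (H ⊗[R] A) ⊗[R] (H ⊗[R] A)) = z
    induction z with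
    | zero => simp only [map_zero, TensorProduct.tmul_zero]
    | add s t hs ht => simp only [map_add, TensorProduct.tmul_add, hs, ht]
    | tmul d e =>
      rw [LinearMap.rTensor_tmul]
      let U : H ⊗[R] A →ₗ[R] (A ⊗[R] H) ⊗[R] (A ⊗[R] H) :=
        TensorProduct.map (TensorProduct.mk R A H (P.α c)) ((TensorProduct.mk R A H).flip (P.β e))
      refine Eq.trans (b := U (TensorProduct.comm R A H (P.cross d))) ?_ ?_
      · rw [cross_apply]
        generalize (comul d : (H ⊗[R] A) ⊗[R] (H ⊗[R] A)) = z
        induction z with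
        | zero => simp only [map_zero, TensorProduct.tmul_zero, TensorProduct.zero_tmul]
        | add s t hs ht =>
          simp only [map_add, TensorProduct.tmul_add, TensorProduct.add_tmul, hs, ht]
        | tmul d f => rfl
      · rw [← hc]
        generalize (comul d : (H ⊗[R] A) ⊗[R] (H ⊗[R] A)) = z
        induction z with
        | zero => simp only [map_zero, TensorProduct.tmul_zero, TensorProduct.zero_tmul]
        | add s t hs ht =>
          simp only [map_add, TensorProduct.tmul_add, TensorProduct.add_tmul, hs, ht]
        | tmul d f => rfl

theorem comul_mulAux (t u : A ⊗[R] H) :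
    comul (R := R) (P.mulAux t u) =
      TensorProduct.map (TensorProduct.lift P.mulAux) (TensorProduct.lift P.mulAux)
        (TensorProduct.AlgebraTensorModule.tensorTensorTensorComm R R R R _ _ _ _
          (comul (R := R) t ⊗ₜ[R] comul (R := R) u)) := by
  induction t with
  | zero => simp
  | add s t hs ht => simp only [map_add, LinearMap.add_apply, TensorProduct.add_tmul, hs, ht]
  | tmul a x =>
    induction u with
    | zero => simp
    | add s t hs ht => simp only [map_add, TensorProduct.tmul_add, hs, ht]
    | tmul b y =>
      rw [mulAux_tmul]
      set r := ℛ R a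
      set s := ℛ R y
      have h : ∀ t : A ⊗[R] H, comul (R := R) (sandwich R A H a y t) =
          ∑ i ∈ r.index, ∑ j ∈ s.index,
            TensorProduct.map (sandwich R A H (r.left i) (s.left j))
              (sandwich R A H (r.right i) (s.right j)) (comul t) := by
        intro t
        induction t with
        | zero => simp
        | add s t hs ht => simp only [map_add, hs, ht, Finset.sum_add_distrib]
        | tmul p h =>
          rw [sandwich_tmul, comul_tmul, comul_tmul, Bialgebra.comul_mul, Bialgebra.comul_mul,
            ← r.eq, ← s.eq]
          generalize (comul p : A ⊗[R] A) = X
          generalize (comul h : H ⊗[R] H) = Y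
          induction X with
          | zero => simp
          | add s t hs ht =>
            simp only [map_add, mul_add, TensorProduct.add_tmul, hs, ht, Finset.sum_add_distrib]
          | tmul x₁ x₂ =>
            induction Y with
            | zero => simp
            | add s t hs ht =>
              simp only [map_add, add_mul, TensorProduct.tmul_add, hs, ht,
                Finset.sum_add_distrib]
            | tmul a₁ a₂ =>
              simp only [Finset.sum_mul, Finset.mul_sum, TensorProduct.sum_tmul,
                TensorProduct.tmul_sum, map_sum, Algebra.TensorProduct.tmul_mul_tmul,
                TensorProduct.AlgebraTensorModule.tensorTensorTensorComm_tmul,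
                TensorProduct.map_tmul, sandwich_tmul]
              try rw [Finset.sum_comm]
      rw [h, comul_cross, comul_tmul, comul_tmul, comul_tmul, ← r.eq, ← s.eq]
      generalize (comul x : H ⊗[R] H) = X
      generalize (comul b : A ⊗[R] A) = Y
      induction X with
      | zero => simp
      | add s t hs ht =>
        simp only [map_add, TensorProduct.add_tmul, TensorProduct.tmul_add, hs, ht,
          Finset.sum_add_distrib]
      | tmul x₁ x₂ =>
        induction Y with
        | zero => simp
        | add s t hs ht =>
          simp only [map_add, TensorProduct.tmul_add, TensorProduct.add_tmul, hs, ht,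
            Finset.sum_add_distrib]
        | tmul b₁ b₂ =>
          simp only [TensorProduct.sum_tmul,
            TensorProduct.tmul_sum, map_sum,
            TensorProduct.AlgebraTensorModule.tensorTensorTensorComm_tmul,
            TensorProduct.map_tmul, TensorProduct.lift.tmul, mulAux_tmul]
          try rw [Finset.sum_comm]

/-- The double cross product `A ⋈ H` of a matched pair of bialgebras: the tensor product `A ⊗ H`
with multiplication `(a ⊗ x) (b ⊗ y) = ∑ a (x₁ ▷ b₁) ⊗ (x₂ ◁ b₂) y` and unit `1 ⊗ 1`, and with the
tensor product coalgebra structure. -/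
def DoubleCrossProduct (_P : BialgebraMatchedPair R A H) : Type _ := A ⊗[R] H

namespace DoubleCrossProduct

instance : AddCommGroup P.DoubleCrossProduct := inferInstanceAs (AddCommGroup (A ⊗[R] H))

instance : Module R P.DoubleCrossProduct := inferInstanceAs (Module R (A ⊗[R] H))

/-- The pure tensor `a ⊗ x` as an element of the double cross product. -/
def tmul (a : A) (x : H) : P.DoubleCrossProduct := a ⊗ₜ[R] x

instance : Ring P.DoubleCrossProduct where
  __ := (inferInstance : AddCommGroup P.DoubleCrossProduct)
  mul t u := P.mulAux t u
  one := tmul P 1 1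
  left_distrib t u v := (P.mulAux t).map_add u v
  right_distrib t u v := P.mulAux.map_add₂ t u v
  zero_mul t := P.mulAux.map_zero₂ t
  mul_zero t := (P.mulAux t).map_zero
  mul_assoc := P.mulAux_assoc
  one_mul := P.one_mulAux
  mul_one := P.mulAux_one

theorem mul_def (t u : P.DoubleCrossProduct) : t * u = P.mulAux t u := rfl

theorem one_def : (1 : P.DoubleCrossProduct) = tmul P 1 1 := rfl

theorem tmul_mul_tmul (a b : A) (x y : H) :
    tmul P a x * tmul P b y = sandwich R A H a y (P.cross (x ⊗ₜ b)) := rfl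

instance : Algebra R P.DoubleCrossProduct :=
  Algebra.ofModule (fun r t u => P.mulAux.map_smul₂ r t u) (fun r t u => (P.mulAux t).map_smul r u)

instance : Coalgebra R P.DoubleCrossProduct := inferInstanceAs (Coalgebra R (A ⊗[R] H))

theorem tensor_mul {B : Type*} [Ring B] [Algebra R B] (z w : B ⊗[R] B) :
    z * w = TensorProduct.map (LinearMap.mul' R B) (LinearMap.mul' R B)
      (TensorProduct.AlgebraTensorModule.tensorTensorTensorComm R R R R B B B B (z ⊗ₜ[R] w)) := by
  induction z with
  | zero => simp
  | add s t hs ht => simp only [add_mul, hs, ht, TensorProduct.add_tmul, map_add]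
  | tmul a x =>
    induction w with
    | zero => simp
    | add s t hs ht => simp only [mul_add, hs, ht, TensorProduct.tmul_add, map_add]
    | tmul b y => simp

instance : Bialgebra R P.DoubleCrossProduct :=
  Bialgebra.mk' R P.DoubleCrossProduct
    (by
      change counit (R := R) ((1 : A) ⊗ₜ[R] (1 : H)) = 1
      simp)
    (fun {t u} => P.counit_mulAux t u)
    (by
      change comul (R := R) ((1 : A) ⊗ₜ[R] (1 : H)) = _
      rw [comul_tmul, Bialgebra.comul_one, Bialgebra.comul_one]
      rfl)
    (fun {t u} => (P.comul_mulAux t u).trans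
      (tensor_mul (R := R) (B := P.DoubleCrossProduct) _ _).symm)

end DoubleCrossProduct

end Bialgebra

section Hopf

variable [HopfAlgebra R A] [HopfAlgebra R H] (P : BialgebraMatchedPair R A H)

namespace DoubleCrossProduct

/-- The antipode of the double cross product, `S (a ⊗ x) = (1 ⊗ S x) (S a ⊗ 1)`. -/
def antipodeAux : P.DoubleCrossProduct →ₗ[R] P.DoubleCrossProduct :=
  P.cross ∘ₗ TensorProduct.map (HopfAlgebra.antipode R) (HopfAlgebra.antipode R) ∘ₗ
    (TensorProduct.comm R A H).toLinearMap

theorem tmul_one_mul_one_tmul (a : A) (x : H) : tmul P a 1 * tmul P 1 x = tmul P a x := by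
  rw [tmul_mul_tmul, cross_one, sandwich_tmul, mul_one, one_mul]
  rfl

theorem tmul_one_mul_tmul_one (a b : A) : tmul P a 1 * tmul P b 1 = tmul P (a * b) 1 := by
  rw [tmul_mul_tmul, one_cross, sandwich_tmul, mul_one]
  rfl

theorem one_tmul_mul_one_tmul (x y : H) : tmul P 1 x * tmul P 1 y = tmul P 1 (x * y) := by
  rw [tmul_mul_tmul, cross_one, sandwich_tmul, mul_one]
  rfl

theorem antipodeAux_tmul (a : A) (x : H) : antipodeAux P (tmul P a x) =
    tmul P 1 (HopfAlgebra.antipode R x) * tmul P (HopfAlgebra.antipode R a) 1 := by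
  rw [tmul_mul_tmul, one_sandwich]
  rfl

theorem comul_tmul_repr {a : A} {x : H} {ι κ : Type*} (r : Repr R a ι) (s : Repr R x κ) :
    comul (R := R) (tmul P a x) = ∑ i ∈ r.index, ∑ j ∈ s.index,
      tmul P (r.left i) (s.left j) ⊗ₜ[R] tmul P (r.right i) (s.right j) := by
  change comul (R := R) (a ⊗ₜ[R] x) = _
  rw [TensorProduct.comul_tmul, ← r.eq, ← s.eq]
  simp only [TensorProduct.sum_tmul, TensorProduct.tmul_sum, map_sum]
  rw [Finset.sum_comm]
  rfl

/-- The inclusion `a ↦ a ⊗ 1`. -/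
def inl : A →ₗ[R] P.DoubleCrossProduct := (TensorProduct.mk R A H).flip 1

/-- The inclusion `x ↦ 1 ⊗ x`. -/
def inr : H →ₗ[R] P.DoubleCrossProduct := TensorProduct.mk R A H 1

theorem counit_tmul (a : A) (x : H) :
    counit (R := R) (tmul P a x) = counit (R := R) x * counit (R := R) a := rfl

theorem hopf_left (a : A) (x : H) :
    LinearMap.mul' R P.DoubleCrossProduct
      ((antipodeAux P).rTensor P.DoubleCrossProduct (comul (tmul P a x))) =
    algebraMap R P.DoubleCrossProduct (counit (R := R) (tmul P a x)) := by
  set r := ℛ R a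
  set s := ℛ R x
  have h1 : ∑ i ∈ r.index, inl P (HopfAlgebra.antipode R (r.left i)) * inl P (r.right i) =
      counit (R := R) a • 1 := by
    have := congr(inl P $(HopfAlgebra.sum_antipode_mul_eq_smul r))
    rw [map_sum, map_smul] at this
    exact (Finset.sum_congr rfl fun i _ => tmul_one_mul_tmul_one P _ _).trans this
  have h2 : ∑ j ∈ s.index, inr P (HopfAlgebra.antipode R (s.left j)) * inr P (s.right j) =
      counit (R := R) x • 1 := by
    have := congr(inr P $(HopfAlgebra.sum_antipode_mul_eq_smul s))
    rw [map_sum, map_smul] at this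
    exact (Finset.sum_congr rfl fun i _ => one_tmul_mul_one_tmul P _ _).trans this
  rw [comul_tmul_repr P r s, counit_tmul, map_mul, Algebra.algebraMap_eq_smul_one, ← h2,
    Finset.sum_comm, Finset.sum_mul]
  simp only [map_sum]
  refine Finset.sum_congr rfl fun j _ => ?_
  rw [mul_assoc, ← Algebra.commutes, Algebra.algebraMap_eq_smul_one, ← h1, Finset.sum_mul,
    Finset.mul_sum]
  refine Finset.sum_congr rfl fun i _ => ?_
  rw [LinearMap.rTensor_tmul, LinearMap.mul'_apply, antipodeAux_tmul,
    ← tmul_one_mul_one_tmul P (r.right i)]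
  simp only [mul_assoc]
  rfl

theorem hopf_right (a : A) (x : H) :
    LinearMap.mul' R P.DoubleCrossProduct
      ((antipodeAux P).lTensor P.DoubleCrossProduct (comul (tmul P a x))) =
    algebraMap R P.DoubleCrossProduct (counit (R := R) (tmul P a x)) := by
  set r := ℛ R a
  set s := ℛ R x
  have h1 : ∑ i ∈ r.index, inl P (r.left i) * inl P (HopfAlgebra.antipode R (r.right i)) =
      counit (R := R) a • 1 := by
    have := congr(inl P $(HopfAlgebra.sum_mul_antipode_eq_smul r))
    rw [map_sum, map_smul] at this
    exact (Finset.sum_congr rfl fun i _ => tmul_one_mul_tmul_one P _ _).trans this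
  have h2 : ∑ j ∈ s.index, inr P (s.left j) * inr P (HopfAlgebra.antipode R (s.right j)) =
      counit (R := R) x • 1 := by
    have := congr(inr P $(HopfAlgebra.sum_mul_antipode_eq_smul s))
    rw [map_sum, map_smul] at this
    exact (Finset.sum_congr rfl fun i _ => one_tmul_mul_one_tmul P _ _).trans this
  rw [comul_tmul_repr P r s, counit_tmul, mul_comm, map_mul, Algebra.algebraMap_eq_smul_one, ← h1,
    Finset.sum_mul]
  simp only [map_sum]
  refine Finset.sum_congr rfl fun i _ => ?_
  rw [mul_assoc, ← Algebra.commutes, Algebra.algebraMap_eq_smul_one, ← h2, Finset.sum_mul,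
    Finset.mul_sum]
  refine Finset.sum_congr rfl fun j _ => ?_
  rw [LinearMap.lTensor_tmul, LinearMap.mul'_apply, antipodeAux_tmul,
    ← tmul_one_mul_one_tmul P (r.left i)]
  simp only [mul_assoc]
  rfl

instance : HopfAlgebra R P.DoubleCrossProduct where
  antipode := antipodeAux P
  mul_antipode_rTensor_comul := by
    refine LinearMap.ext fun t => ?_
    induction t using TensorProduct.induction_on with
    | zero => exact (LinearMap.map_zero _).trans (LinearMap.map_zero _).symm
    | add s t hs ht =>
      exact (LinearMap.map_add _ _ _).trans ((congrArg₂ _ hs ht).trans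
        (LinearMap.map_add _ _ _).symm)
    | tmul a x => exact hopf_left P a x
  mul_antipode_lTensor_comul := by
    refine LinearMap.ext fun t => ?_
    induction t using TensorProduct.induction_on with
    | zero => exact (LinearMap.map_zero _).trans (LinearMap.map_zero _).symm
    | add s t hs ht =>
      exact (LinearMap.map_add _ _ _).trans ((congrArg₂ _ hs ht).trans
        (LinearMap.map_add _ _ _).symm)
    | tmul a x => exact hopf_right P a x

end DoubleCrossProduct

end Hopf

end BialgebraMatchedPair

/-! ### The Lie matched pair induced by a matched pair of enveloping algebras -/

/-- The Lie matched pair `M` is induced by the matched pair `P` of enveloping algebras: the actions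
of `P` restrict to those of `M` along the canonical maps `ι` of `H` and `A` into their enveloping
algebras. -/
def BialgebraMatchedPair.Induces {R A H : Type*} [CommRing R] [LieRing A] [LieAlgebra R A]
    [LieRing H] [LieAlgebra R H]
    (P : BialgebraMatchedPair R (UniversalEnvelopingAlgebra R A) (UniversalEnvelopingAlgebra R H))
    (M : LieMatchedPair R A H) : Prop :=
  ∀ (x : H) (a : A),
    P.α (UniversalEnvelopingAlgebra.ι R x ⊗ₜ UniversalEnvelopingAlgebra.ι R a) =
        UniversalEnvelopingAlgebra.ι R (M.α x a) ∧
      P.β (UniversalEnvelopingAlgebra.ι R x ⊗ₜ UniversalEnvelopingAlgebra.ι R a) =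
        UniversalEnvelopingAlgebra.ι R (M.β x a)

end

/-! The Lie statement comes from linearising the matched pair at primitive elements. For `x` in `H`
and `a` in `A` the coproduct of `x ⊗ a` has four terms, so the compatibility conditions become short
identities such as `x ▷ (ab) = (x ▷ a) b + a (x ▷ b) + (x ◁ a) ▷ b`. Antisymmetrising them gives the
axioms of a Lie matched pair, but only inside the enveloping algebras. They descend to `A` and `H`,
and the induced pair is unique, because `ι` is injective. This is the weak form of the
Poincaré–Birkhoff–Witt theorem, `ι_injective`: a Lie algebra with basis `b` acts on the span of the
ordered monomials in `b`, and applying an element to the empty monomial recovers its coordinates.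
The hard point is that this is an action, `pbwAction_lie`.

For the isomorphism, two maps go in opposite directions. The multiplication `u ⊗ v ↦ uv` from `U(A)
⊗ U(H)` to `U(A ⋈ H)` is onto, since `xa = ax + [x, a]` with `[x, a] = x ▷ a + x ◁ a` moves elements
of `A` to the left (`envelopingMul_surjective`). The same relation holds in the double cross
product, so `(a, x) ↦ a ⊗ 1 + 1 ⊗ x` extends to an algebra morphism `ofEnveloping`, which is a left
inverse of the multiplication map. Both maps are therefore bijective, without a monomial basis of
`U(A ⋈ H)`. Compatibility with coproduct, counit and antipode is decided on the generators. -/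

noncomputable section

namespace UniversalEnvelopingAlgebra

/-! ### Injectivity of the canonical map into the enveloping algebra -/

section Embedding

open Finsupp

variable {R L I : Type*} [CommRing R] [LieRing L] [LieAlgebra R L]

@[elab_as_elim]
theorem basis_induction (b : Module.Basis I R L) {p : L → Prop} (x : L) (zero : p 0)
    (add : ∀ x y, p x → p y → p (x + y)) (smul : ∀ (r : R) x, p x → p (r • x))
    (basis : ∀ i, p (b i)) : p x :=
  Submodule.span_induction (p := fun x _ => p x) (by rintro _ ⟨i, rfl⟩; exact basis i) zero
    (fun x y _ _ => add x y) (fun r x _ => smul r x) (b.mem_span x)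

theorem exists_cons_least [LinearOrder I] {s : Multiset I} (hs : s ≠ 0) :
    ∃ (j : I) (t : Multiset I), (∀ l ∈ t, j ≤ l) ∧ s = j ::ₘ t := by
  obtain ⟨j, hj, hle⟩ := s.toFinset.exists_minimal (by simpa using hs)
  rw [Multiset.mem_toFinset] at hj
  obtain ⟨t, rfl⟩ := Multiset.exists_cons_of_mem hj
  exact ⟨j, t, fun l hl => (le_total j l).elim id fun h => hle (by simp [hl]) h, rfl⟩

variable (R I) in
/-- The span of the monomials of degree at most `n`. -/
def degreeLE (n : ℕ) : Submodule R (Multiset I →₀ R) := supported R R {s | s.card ≤ n}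

theorem single_mem_degreeLE {s : Multiset I} {n : ℕ} (h : s.card ≤ n) :
    single s 1 ∈ degreeLE R I n :=
  single_mem_supported R 1 h

theorem degreeLE_mono {m n : ℕ} (h : m ≤ n) : degreeLE R I m ≤ degreeLE R I n :=
  supported_mono fun _ hs => le_trans hs h

theorem degreeLE_le_iff {n : ℕ} {p : Submodule R (Multiset I →₀ R)} :
    degreeLE R I n ≤ p ↔ ∀ s : Multiset I, s.card ≤ n → single s 1 ∈ p := by
  rw [degreeLE, supported_eq_span_single, Submodule.span_le, Set.image_subset_iff]
  rfl

variable [LinearOrder I] (b : Module.Basis I R L)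

open Classical in
/-- Approximations to the action of `L` on the span of the ordered monomials in the basis `b`: the
`n`-th one is correct on monomials of degree at most `n`. -/
def pbwStage : ℕ → L →ₗ[R] Module.End R (Multiset I →₀ R)
  -- Correct only on the empty monomial. Elsewhere it is a default, chosen to have the right leading
  -- term so that the degree bounds hold at every stage.
  | 0 => b.constr R fun i => linearCombination R fun s => single (i ::ₘ s) 1
  | n + 1 => b.constr R fun i => linearCombination R fun s =>
      if h : ∃ j ∈ s, (∀ l ∈ s, j ≤ l) ∧ j < i then
        -- With `s = j t` and `j` least, an action must satisfy `i·(j·t) = j·(i·t) + [i, j]·t`.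
        -- Split `i·t` into the monomial `i t` and a remainder: `j` sends `i t` to `i j t`, and the
        -- remainder has degree at most that of `t`, where the previous stage is available.
        single (i ::ₘ s) 1 +
          pbwStage n (b h.choose) (pbwStage n (b i) (single (s.erase h.choose) 1) -
            single (i ::ₘ s.erase h.choose) 1) +
          pbwStage n ⁅b i, b h.choose⁆ (single (s.erase h.choose) 1)
      else single (i ::ₘ s) 1

theorem pbwStage_zero_single (i : I) (s : Multiset I) :
    pbwStage b 0 (b i) (single s 1) = single (i ::ₘ s) 1 := by
  simp [pbwStage]

theorem pbwStage_of_le (n : ℕ) {i : I} {s : Multiset I} (h : ∀ l ∈ s, i ≤ l) :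
    pbwStage b n (b i) (single s 1) = single (i ::ₘ s) 1 := by
  cases n with
  | zero => exact pbwStage_zero_single b i s
  | succ n =>
    have : ¬ ∃ j ∈ s, (∀ l ∈ s, j ≤ l) ∧ j < i := by
      rintro ⟨j, hj, -, hji⟩
      exact (h j hj).not_gt hji
    simp only [pbwStage, Module.Basis.constr_basis, linearCombination_single, one_smul, dif_neg this]

theorem pbwStage_of_lt (n : ℕ) {i j : I} {t : Multiset I} (h : ∀ l ∈ t, j ≤ l) (hji : j < i) :
    pbwStage b (n + 1) (b i) (single (j ::ₘ t) 1) = single (i ::ₘ j ::ₘ t) 1 +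
      pbwStage b n (b j) (pbwStage b n (b i) (single t 1) - single (i ::ₘ t) 1) +
      pbwStage b n ⁅b i, b j⁆ (single t 1) := by
  have hj : ∀ l ∈ j ::ₘ t, j ≤ l := by simpa using h
  have hex : ∃ j' ∈ j ::ₘ t, (∀ l ∈ j ::ₘ t, j' ≤ l) ∧ j' < i :=
    ⟨j, Multiset.mem_cons_self j t, hj, hji⟩
  have hc : hex.choose = j :=
    le_antisymm (hex.choose_spec.2.1 j (Multiset.mem_cons_self j t)) (hj _ hex.choose_spec.1)
  simp only [pbwStage, Module.Basis.constr_basis, linearCombination_single, one_smul, dif_pos hex,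
    hc, Multiset.erase_cons_head]

attribute [irreducible] pbwStage

/-- `H` is the leading-term property of stage `m`. It is a hypothesis here so that the induction
proving it can use this degree bound at the preceding stage. -/
theorem pbwStage_mem (m : ℕ) (H : ∀ (i : I) (s : Multiset I),
      pbwStage b m (b i) (single s 1) - single (i ::ₘ s) 1 ∈ degreeLE R I s.card)
    (x : L) {n : ℕ} {v : Multiset I →₀ R} (hv : v ∈ degreeLE R I n) :
    pbwStage b m x v ∈ degreeLE R I (n + 1) := by
  suffices h : degreeLE R I n ≤ (degreeLE R I (n + 1)).comap (pbwStage b m x) from h hv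
  rw [degreeLE_le_iff]
  intro s hs
  change x ∈ (degreeLE R I (n + 1)).comap ((pbwStage b m).flip (single s 1))
  induction x using basis_induction b with
  | zero => exact zero_mem _
  | add x y hx hy => exact add_mem hx hy
  | smul r x hx => exact Submodule.smul_mem _ r hx
  | basis i =>
    have := add_mem (degreeLE_mono (hs.trans n.le_succ) (H i s))
      (single_mem_degreeLE (R := R) (s := i ::ₘ s) (n := n + 1) (by simpa using hs))
    simpa using this

/-- Reordering costs only lower terms: for `s = j t` both corrections apply one element of `L` to a
vector of degree at most `|t|`, so their degree is at most `|t| + 1 = |s|`. -/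
theorem pbwStage_sub_mem (m : ℕ) (i : I) (s : Multiset I) :
    pbwStage b m (b i) (single s 1) - single (i ::ₘ s) 1 ∈ degreeLE R I s.card := by
  induction m generalizing i s with
  | zero =>
    rw [pbwStage_zero_single, sub_self]
    exact zero_mem _
  | succ m ih =>
    by_cases h : ∀ l ∈ s, i ≤ l
    · rw [pbwStage_of_le b _ h, sub_self]
      exact zero_mem _
    · obtain ⟨j, t, hj, rfl⟩ := exists_cons_least (s := s) (by rintro rfl; simp at h)
      have hji : j < i := by
        by_contra! hij
        exact h (by simpa [hij] using fun l hl => hij.trans (hj l hl))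
      rw [pbwStage_of_lt b m hj hji, add_assoc, add_sub_cancel_left, Multiset.card_cons]
      exact add_mem (pbwStage_mem b m ih _ (ih i t))
        (pbwStage_mem b m ih _ (single_mem_degreeLE le_rfl))

/-- The rule for a monomial `j t` of degree `m + 1` calls the previous stage only on `t` and on `i·t
- i t`, both of degree at most `m`. This is why the leading term was split off in the definition. -/
theorem pbwStage_succ (m : ℕ) (x : L) {v : Multiset I →₀ R} (hv : v ∈ degreeLE R I m) :
    pbwStage b (m + 1) x v = pbwStage b m x v := by
  induction m generalizing x v with
  | zero =>
    suffices h : degreeLE R I 0 ≤ LinearMap.eqLocus (pbwStage b 1 x) (pbwStage b 0 x) from h hv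
    rw [degreeLE_le_iff]
    intro s hs
    obtain rfl : s = 0 := by simpa using hs
    rw [LinearMap.mem_eqLocus]
    refine DFunLike.congr_fun (f := (pbwStage b 1).flip (single 0 1))
      (g := (pbwStage b 0).flip (single 0 1)) (b.ext fun i => ?_) x
    rw [LinearMap.flip_apply, LinearMap.flip_apply, pbwStage_of_le b _ (by simp),
      pbwStage_of_le b _ (by simp)]
  | succ m ih =>
    suffices h : degreeLE R I (m + 1) ≤
        LinearMap.eqLocus (pbwStage b (m + 2) x) (pbwStage b (m + 1) x) from h hv
    rw [degreeLE_le_iff]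
    intro s hs
    rw [LinearMap.mem_eqLocus]
    refine DFunLike.congr_fun (f := (pbwStage b (m + 2)).flip (single s 1))
      (g := (pbwStage b (m + 1)).flip (single s 1)) (b.ext fun i => ?_) x
    rw [LinearMap.flip_apply, LinearMap.flip_apply]
    by_cases h : ∀ l ∈ s, i ≤ l
    · rw [pbwStage_of_le b _ h, pbwStage_of_le b _ h]
    · obtain ⟨j, t, hj, rfl⟩ := exists_cons_least (s := s) (by rintro rfl; simp at h)
      have hji : j < i := by
        by_contra! hij
        exact h (by simpa [hij] using fun l hl => hij.trans (hj l hl))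
      have ht : t.card ≤ m := by simpa using hs
      rw [pbwStage_of_lt b _ hj hji, pbwStage_of_lt b _ hj hji,
        ih _ (single_mem_degreeLE ht), ih _ (single_mem_degreeLE ht),
        ih _ (degreeLE_mono ht (pbwStage_sub_mem b m i t))]

/-- The action of `L` on the span of the ordered monomials in the basis `b`. -/
def pbwAction : L →ₗ[R] Module.End R (Multiset I →₀ R) where
  -- From stage `s.card` on, the value on `s` no longer changes.
  toFun x := linearCombination R fun s => pbwStage b s.card x (single s 1)
  map_add' x y := by ext; simp
  map_smul' r x := by ext; simp

theorem pbwAction_single {m : ℕ} (x : L) {s : Multiset I} (hs : s.card ≤ m) :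
    pbwAction b x (single s 1) = pbwStage b m x (single s 1) := by
  induction m, hs using Nat.le_induction with
  | base => simp [pbwAction]
  | succ n hn ih => rw [pbwStage_succ b n x (single_mem_degreeLE hn), ih]

theorem pbwAction_eq {m : ℕ} (x : L) {v : Multiset I →₀ R} (hv : v ∈ degreeLE R I m) :
    pbwAction b x v = pbwStage b m x v := by
  suffices h : degreeLE R I m ≤ LinearMap.eqLocus (pbwAction b x) (pbwStage b m x) from h hv
  rw [degreeLE_le_iff]
  intro s hs
  exact pbwAction_single b x hs

theorem pbwAction_of_le {i : I} {s : Multiset I} (h : ∀ l ∈ s, i ≤ l) :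
    pbwAction b (b i) (single s 1) = single (i ::ₘ s) 1 := by
  rw [pbwAction_eq b _ (single_mem_degreeLE le_rfl), pbwStage_of_le b _ h]

theorem pbwAction_sub_mem (i : I) (s : Multiset I) :
    pbwAction b (b i) (single s 1) - single (i ::ₘ s) 1 ∈ degreeLE R I s.card := by
  rw [pbwAction_eq b _ (single_mem_degreeLE le_rfl)]
  exact pbwStage_sub_mem b _ i s

/-- Since `j` lies below `i` and `t`, it acts on the monomial `i t` by adjoining `j`. The subtracted
term thus cancels the leading monomial of the recursive rule. -/
theorem pbwAction_of_lt {i j : I} {t : Multiset I} (h : ∀ l ∈ t, j ≤ l) (hji : j < i) :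
    pbwAction b (b i) (single (j ::ₘ t) 1) =
      pbwAction b (b j) (pbwAction b (b i) (single t 1)) +
        pbwAction b ⁅b i, b j⁆ (single t 1) := by
  have hd := pbwAction_sub_mem b i t
  have hij : pbwAction b (b j) (single (i ::ₘ t) 1) = single (i ::ₘ j ::ₘ t) 1 := by
    rw [pbwAction_of_le b (by simpa [hji.le] using h), Multiset.cons_swap]
  rw [pbwAction_eq b (b i) (m := t.card + 1) (single_mem_degreeLE (by simp)),
    pbwStage_of_lt b _ h hji, ← pbwAction_eq b _ (single_mem_degreeLE le_rfl),
    ← pbwAction_eq b _ (single_mem_degreeLE le_rfl), ← pbwAction_eq b _ hd, map_sub, hij,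
    add_sub_cancel]

/-- If `j < i`, this is the defining rule, because `j` acts on `s` by adjoining itself. If `i < j`,
then `i` also lies below `s` and the same argument applies with the roles exchanged. -/
theorem pbwAction_lie_of_le (i : I) {j : I} {s : Multiset I} (h : ∀ l ∈ s, j ≤ l) :
    pbwAction b ⁅b i, b j⁆ (single s 1) =
      pbwAction b (b i) (pbwAction b (b j) (single s 1)) -
        pbwAction b (b j) (pbwAction b (b i) (single s 1)) := by
  rcases lt_trichotomy j i with hji | rfl | hij
  · rw [pbwAction_of_le b h, pbwAction_of_lt b h hji, add_sub_cancel_left]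
  · simp
  · have hi : ∀ l ∈ s, i ≤ l := fun l hl => hij.le.trans (h l hl)
    rw [pbwAction_of_le b hi, pbwAction_of_lt b hi hij, ← lie_skew, map_neg, LinearMap.neg_apply]
    abel

/-- Induction on the degree. The case not settled by `pbwAction_lie_of_le` is a monomial `k t` whose
least index `k` is below both `i` and `j`. There both products are moved past `k`, and the Jacobi
identity matches the results. -/
theorem pbwAction_lie (x y : L) : pbwAction b ⁅x, y⁆ =
    pbwAction b x * pbwAction b y - pbwAction b y * pbwAction b x := by
  have extend : ∀ v : Multiset I →₀ R,
      (∀ i j, pbwAction b ⁅b i, b j⁆ v = pbwAction b (b i) (pbwAction b (b j) v) -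
        pbwAction b (b j) (pbwAction b (b i) v)) →
      ∀ x y, pbwAction b ⁅x, y⁆ v = pbwAction b x (pbwAction b y v) -
        pbwAction b y (pbwAction b x v) := by
    intro v hv x y
    induction x using basis_induction b with
    | zero => simp
    | add x x' hx hx' => simp only [add_lie, map_add, LinearMap.add_apply, hx, hx']; abel
    | smul r x hx => simp only [smul_lie, map_smul, LinearMap.smul_apply, hx, smul_sub]
    | basis i =>
      induction y using basis_induction b with
      | zero => simp
      | add x x' hx hx' => simp only [lie_add, map_add, LinearMap.add_apply, hx, hx']; abel
      | smul r x hx => simp only [lie_smul, map_smul, LinearMap.smul_apply, hx, smul_sub]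
      | basis j => exact hv i j
  have key : ∀ n : ℕ, ∀ v ∈ degreeLE R I n, ∀ x y, pbwAction b ⁅x, y⁆ v =
      pbwAction b x (pbwAction b y v) - pbwAction b y (pbwAction b x v) := by
    intro n
    induction n with
    | zero =>
      intro v hv x y
      suffices h : degreeLE R I 0 ≤ LinearMap.eqLocus (pbwAction b ⁅x, y⁆)
        (pbwAction b x * pbwAction b y - pbwAction b y * pbwAction b x) from h hv
      rw [degreeLE_le_iff]
      intro s hs
      obtain rfl : s = 0 := by simpa using hs
      exact extend _ (fun i j => pbwAction_lie_of_le b i (by simp)) x y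
    | succ n ih =>
      intro v hv x y
      suffices h : degreeLE R I (n + 1) ≤ LinearMap.eqLocus (pbwAction b ⁅x, y⁆)
        (pbwAction b x * pbwAction b y - pbwAction b y * pbwAction b x) from h hv
      rw [degreeLE_le_iff]
      intro s hs
      refine extend _ (fun i j => ?_) x y
      by_cases hj : ∀ l ∈ s, j ≤ l
      · exact pbwAction_lie_of_le b i hj
      by_cases hi : ∀ l ∈ s, i ≤ l
      · rw [← lie_skew, map_neg, LinearMap.neg_apply, pbwAction_lie_of_le b j hi, neg_sub]
      obtain ⟨k, t, hk, rfl⟩ := exists_cons_least (s := s) (by rintro rfl; simp at hj)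
      have ht : t.card ≤ n := by simpa using hs
      have hlt : ∀ i, (¬ ∀ l ∈ k ::ₘ t, i ≤ l) → k < i := by
        intro i h
        by_contra! hik
        exact h (by simpa [hik] using fun l hl => hik.trans (hk l hl))
      have ht' := ih _ (single_mem_degreeLE (R := R) ht)
      -- Up to terms of degree at most `|t|`, which the induction hypothesis covers, `j·t` is the
      -- monomial `j t`. Since `k` lies below `j t`, `pbwAction_lie_of_le` covers the leading term.
      have swap : ∀ i j, k < j → pbwAction b (b i) (pbwAction b (b k)
          (pbwAction b (b j) (single t 1))) = pbwAction b (b k) (pbwAction b (b i)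
          (pbwAction b (b j) (single t 1))) + pbwAction b ⁅b i, b k⁆
          (pbwAction b (b j) (single t 1)) := by
        intro i j hkj
        have h1 := ih _ (degreeLE_mono ht (pbwAction_sub_mem b j t)) (b i) (b k)
        have h2 := pbwAction_lie_of_le b i (j := k) (s := j ::ₘ t) (by simpa [hkj.le] using hk)
        simp only [map_sub] at h1
        linear_combination (norm := module) (-1 : R) • h1 - (1 : R) • h2
      have expand : ∀ i j, k < j → pbwAction b (b i) (pbwAction b (b j) (single (k ::ₘ t) 1)) =
          pbwAction b (b k) (pbwAction b (b i) (pbwAction b (b j) (single t 1))) +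
          pbwAction b ⁅b i, b k⁆ (pbwAction b (b j) (single t 1)) +
          pbwAction b ⁅b j, b k⁆ (pbwAction b (b i) (single t 1)) +
          pbwAction b ⁅b i, ⁅b j, b k⁆⁆ (single t 1) := by
        intro i j hkj
        rw [pbwAction_of_lt b hk hkj, map_add, swap i j hkj, ht' (b i) ⁅b j, b k⁆]
        abel
      -- The two middle terms of `expand` are exchanged by `i ↔ j` and cancel in the difference.
      -- What remains is `k·([i, j]·t) + [[i, j], k]·t`, by Jacobi, and this equals `[i, j]·(k·t)`
      -- by the induction hypothesis.
      rw [expand i j (hlt j hj), expand j i (hlt i hi), ← pbwAction_of_le b hk,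
        leibniz_lie (b i) (b j) (b k), map_add, LinearMap.add_apply, ht' ⁅b i, b j⁆ (b k),
        ht' (b i) (b j), map_sub]
      abel
  ext1 s
  refine LinearMap.ext_ring ?_
  exact key s.card _ (single_mem_degreeLE le_rfl) x y

theorem pbwAction_single_zero (x : L) :
    pbwAction b x (single 0 1) = mapDomain (fun i : I => ({i} : Multiset I)) (b.repr x) := by
  change (pbwAction b).flip (single 0 1) x =
    (lmapDomain R R (fun i : I => ({i} : Multiset I)) ∘ₗ b.repr.toLinearMap) x
  congr 1
  refine b.ext fun i => ?_
  rw [LinearMap.flip_apply, pbwAction_of_le b (by simp)]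
  simp

/-- The action extends to the enveloping algebra, so `ι x` determines `x` applied to the empty
monomial, hence the coordinates of `x`. -/
theorem ι_injective_of_basis (b : Module.Basis I R L) : Function.Injective (ι R : L → UniversalEnvelopingAlgebra R L) := by
  intro x y h
  have h' := congrArg (lift R (lieHomOfCommutator R L (B := Module.End R (Multiset I →₀ R))
    (pbwAction b) (pbwAction_lie b))) h
  rw [lift_ι_apply, lift_ι_apply] at h'
  have := DFunLike.congr_fun h' (single 0 1)
  change pbwAction b x _ = pbwAction b y _ at this
  rw [pbwAction_single_zero, pbwAction_single_zero] at this
  exact b.repr.injective (mapDomain_injective (fun i j hij => by simpa using hij) this)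

open Classical in
/-- The canonical map of a Lie algebra that is free as a module into its enveloping algebra is
injective. -/
theorem ι_injective [Module.Free R L] :
    Function.Injective (ι R : L → UniversalEnvelopingAlgebra R L) :=
  -- Any linear order would do: monomials are finite, so least indices exist.
  letI : LinearOrder (Module.Free.ChooseBasisIndex R L) := linearOrderOfSTO WellOrderingRel
  ι_injective_of_basis (Module.Free.chooseBasis R L)

end Embedding

end UniversalEnvelopingAlgebra

/-! ### Restriction of a matched pair of enveloping algebras to primitive elements -/

section Induced

attribute [local instance 100] LieRing.ofAssociativeRing

variable {R A H : Type*} [CommRing R] [LieRing A] [LieAlgebra R A] [LieRing H] [LieAlgebra R H]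

open UniversalEnvelopingAlgebra

namespace BialgebraMatchedPair

variable (P : BialgebraMatchedPair R (UniversalEnvelopingAlgebra R A)
  (UniversalEnvelopingAlgebra R H))

/-- Of the four terms of the coproduct, the one with `x ▷ 1` and `1 ◁ a` vanishes because `ε` kills
primitive elements. -/
theorem cross_ι_tmul_ι (x : H) (a : A) : P.cross (ι R x ⊗ₜ ι R a) =
    P.α (ι R x ⊗ₜ ι R a) ⊗ₜ 1 + ι R a ⊗ₜ ι R x + 1 ⊗ₜ P.β (ι R x ⊗ₜ ι R a) := by
  rw [cross_apply, TensorProduct.comul_tmul, comul_ι, comul_ι]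
  simp only [TensorProduct.add_tmul, TensorProduct.tmul_add, map_add,
    TensorProduct.AlgebraTensorModule.tensorTensorTensorComm_tmul, TensorProduct.map_tmul,
    CoalgHom.coe_toLinearMap, P.α_one, P.one_α, P.β_one, P.one_β, counit_ι, zero_smul,
    TensorProduct.zero_tmul, Bialgebra.counit_one, one_smul]
  abel

/-- The Leibniz rule twisted by `◁`; its antisymmetrisation in `a` and `b` is the axiom `α_lie`. -/
theorem α_ι_mul_ι (x : H) (a b : A) : P.α (ι R x ⊗ₜ (ι R a * ι R b)) =
    P.α (ι R x ⊗ₜ ι R a) * ι R b + ι R a * P.α (ι R x ⊗ₜ ι R b) +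
      P.α (P.β (ι R x ⊗ₜ ι R a) ⊗ₜ ι R b) := by
  rw [P.α_mul]
  change LinearMap.mul' R _ (LinearMap.lTensor _ _ (P.cross _)) = _
  rw [cross_ι_tmul_ι]
  simp [-ι_apply, P.one_α]

theorem β_ι_mul_ι (x y : H) (a : A) : P.β ((ι R x * ι R y) ⊗ₜ ι R a) =
    P.β (ι R x ⊗ₜ P.α (ι R y ⊗ₜ ι R a)) + P.β (ι R x ⊗ₜ ι R a) * ι R y +
      ι R x * P.β (ι R y ⊗ₜ ι R a) := by
  rw [P.mul_β]
  change LinearMap.mul' R _ (LinearMap.rTensor _ _ (P.cross _)) = _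
  rw [cross_ι_tmul_ι]
  simp [-ι_apply, P.β_one]

variable {P}

/-- A pair of bilinear maps through which the actions of `P` restrict along injective canonical
maps is a matched pair of Lie algebras. -/
def inducedLieMatchedPair (hA : Function.Injective (ι R : A → UniversalEnvelopingAlgebra R A))
    (hH : Function.Injective (ι R : H → UniversalEnvelopingAlgebra R H))
    (α : H →ₗ[R] A →ₗ[R] A) (β : H →ₗ[R] A →ₗ[R] H)
    (hα : ∀ x a, P.α (ι R x ⊗ₜ ι R a) = ι R (α x a))
    (hβ : ∀ x a, P.β (ι R x ⊗ₜ ι R a) = ι R (β x a)) : LieMatchedPair R A H where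
  α := α
  β := β
  lie_α x y a := hA <| by
    rw [← hα, ι_lie, TensorProduct.sub_tmul, map_sub, P.mul_α, P.mul_α, hα, hα, hα, hα, map_sub]
  β_lie x a b := hH <| by
    rw [← hβ, ι_lie, TensorProduct.tmul_sub, map_sub, P.β_mul, P.β_mul, hβ, hβ, hβ, hβ, map_sub]
  α_lie x a b := hA <| by
    rw [← hα, ι_lie, TensorProduct.tmul_sub, map_sub, α_ι_mul_ι, α_ι_mul_ι]
    simp only [hα, hβ, map_sub, map_add, ι_lie]
    abel
  lie_β x y a := hH <| by
    rw [← hβ, ι_lie, TensorProduct.sub_tmul, map_sub, β_ι_mul_ι, β_ι_mul_ι]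
    simp only [hα, hβ, map_sub, map_add, ι_lie]
    abel

end BialgebraMatchedPair

/-- Preimages under an injective map are unique, so choosing them pointwise is automatically
bilinear. -/
theorem exists_bilinear_of_forall_exists {R L M N V : Type*} [CommRing R] [AddCommGroup L]
    [AddCommGroup M] [AddCommGroup N] [AddCommGroup V] [Module R L] [Module R M] [Module R N]
    [Module R V] {i : N →ₗ[R] V} (hi : Function.Injective i) (f : L →ₗ[R] M →ₗ[R] V)
    (h : ∀ x a, ∃ b, f x a = i b) :
    ∃ g : L →ₗ[R] M →ₗ[R] N, ∀ x a, f x a = i (g x a) := by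
  choose g hg using h
  exact ⟨LinearMap.mk₂ R g
    (fun x y a => hi (by simp only [map_add, ← hg, LinearMap.add_apply]))
    (fun r x a => hi (by simp only [map_smul, ← hg, LinearMap.smul_apply]))
    (fun x a b => hi (by simp only [map_add, ← hg]))
    (fun r x a => hi (by simp only [map_smul, ← hg])), hg⟩

namespace BialgebraMatchedPair

variable (P : BialgebraMatchedPair R (UniversalEnvelopingAlgebra R A)
  (UniversalEnvelopingAlgebra R H))

theorem existsUnique_induces
    (hA : Function.Injective (ι R : A → UniversalEnvelopingAlgebra R A))
    (hH : Function.Injective (ι R : H → UniversalEnvelopingAlgebra R H))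
    (hα : ∀ (x : H) (a : A), ∃ b : A, P.α (ι R x ⊗ₜ ι R a) = ι R b)
    (hβ : ∀ (x : H) (a : A), ∃ y : H, P.β (ι R x ⊗ₜ ι R a) = ι R y) :
    ∃! M : LieMatchedPair R A H, P.Induces M := by
  obtain ⟨α, hα'⟩ := exists_bilinear_of_forall_exists
    (i := (ι R : A →ₗ⁅R⁆ _).toLinearMap) hA
    ((TensorProduct.curry P.αₗ).compl₁₂ (ι R : H →ₗ⁅R⁆ _).toLinearMap
      (ι R : A →ₗ⁅R⁆ _).toLinearMap) hα
  obtain ⟨β, hβ'⟩ := exists_bilinear_of_forall_exists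
    (i := (ι R : H →ₗ⁅R⁆ _).toLinearMap) hH
    ((TensorProduct.curry P.βₗ).compl₁₂ (ι R : H →ₗ⁅R⁆ _).toLinearMap
      (ι R : A →ₗ⁅R⁆ _).toLinearMap) hβ
  refine ⟨inducedLieMatchedPair hA hH α β hα' hβ', fun x a => ⟨hα' x a, hβ' x a⟩, fun M hM => ?_⟩
  refine LieMatchedPair.ext ?_ ?_
  · exact LinearMap.ext₂ fun x a => hA ((hM x a).1.symm.trans (hα' x a))
  · exact LinearMap.ext₂ fun x a => hH ((hM x a).2.symm.trans (hβ' x a))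

end BialgebraMatchedPair

end Induced

/-! ### The factorisation of `U(A ⋈ H)` and its comparison with the double cross product -/

section Isomorphism

attribute [local instance 100] LieRing.ofAssociativeRing

open UniversalEnvelopingAlgebra BialgebraMatchedPair

variable {R A H : Type*} [CommRing R] [LieRing A] [LieAlgebra R A] [LieRing H] [LieAlgebra R H]

namespace LieMatchedPair

variable (M : LieMatchedPair R A H)

namespace DoubleCrossSum

/-- The inclusion `a ↦ (a, 0)`. -/
def inl : A →ₗ[R] M.DoubleCrossSum := LinearMap.inl R A H

/-- The inclusion `x ↦ (0, x)`. -/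
def inr : H →ₗ[R] M.DoubleCrossSum := LinearMap.inr R A H

theorem inl_add_inr (p : M.DoubleCrossSum) : inl M p.1 + inr M p.2 = p :=
  Prod.ext (add_zero p.1) (zero_add p.2)

theorem inl_lie (a b : A) : inl M ⁅a, b⁆ = ⁅inl M a, inl M b⁆ := by
  refine Prod.ext ?_ ?_
  · change ⁅a, b⁆ = ⁅a, b⁆ + M.α 0 b - M.α 0 a
    simp
  · change (0 : H) = ⁅(0 : H), 0⁆ + M.β 0 b - M.β 0 a
    simp

theorem inr_lie (x y : H) : inr M ⁅x, y⁆ = ⁅inr M x, inr M y⁆ := by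
  refine Prod.ext ?_ ?_
  · change (0 : A) = ⁅(0 : A), 0⁆ + M.α x 0 - M.α y 0
    simp
  · change ⁅x, y⁆ = ⁅x, y⁆ + M.β x 0 - M.β y 0
    simp

theorem inr_lie_inl (x : H) (a : A) : ⁅inr M x, inl M a⁆ = inl M (M.α x a) + inr M (M.β x a) := by
  refine Prod.ext ?_ ?_
  · change ⁅(0 : A), a⁆ + M.α x a - M.α 0 0 = M.α x a + 0
    simp
  · change ⁅x, (0 : H)⁆ + M.β x a - M.β 0 0 = 0 + M.β x a
    simp

/-- The algebra morphism `U(A) → U(A ⋈ H)` induced by the inclusion. -/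
def envelopingInl : UniversalEnvelopingAlgebra R A →ₐ[R]
    UniversalEnvelopingAlgebra R M.DoubleCrossSum :=
  UniversalEnvelopingAlgebra.lift R <| lieHomOfCommutator R A ((ι R : M.DoubleCrossSum →ₗ⁅R⁆ _).toLinearMap ∘ₗ inl M)
    fun a b => by
      change ι R (inl M ⁅a, b⁆) = _
      rw [inl_lie, ι_lie]
      rfl

/-- The algebra morphism `U(H) → U(A ⋈ H)` induced by the inclusion. -/
def envelopingInr : UniversalEnvelopingAlgebra R H →ₐ[R]
    UniversalEnvelopingAlgebra R M.DoubleCrossSum :=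
  UniversalEnvelopingAlgebra.lift R <| lieHomOfCommutator R H ((ι R : M.DoubleCrossSum →ₗ⁅R⁆ _).toLinearMap ∘ₗ inr M)
    fun x y => by
      change ι R (inr M ⁅x, y⁆) = _
      rw [inr_lie, ι_lie]
      rfl

theorem envelopingInl_ι (a : A) : envelopingInl M (ι R a) = ι R (inl M a) := lift_ι_apply R _ a

theorem envelopingInr_ι (x : H) : envelopingInr M (ι R x) = ι R (inr M x) := lift_ι_apply R _ x

/-- The multiplication map `U(A) ⊗ U(H) → U(A ⋈ H)`. -/
def envelopingMul : UniversalEnvelopingAlgebra R A ⊗[R] UniversalEnvelopingAlgebra R H →ₗ[R]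
    UniversalEnvelopingAlgebra R M.DoubleCrossSum :=
  LinearMap.mul' R _ ∘ₗ
    TensorProduct.map (envelopingInl M).toLinearMap (envelopingInr M).toLinearMap

theorem envelopingMul_tmul (u : UniversalEnvelopingAlgebra R A)
    (v : UniversalEnvelopingAlgebra R H) :
    envelopingMul M (u ⊗ₜ v) = envelopingInl M u * envelopingInr M v := rfl

theorem envelopingInl_mul_mem_range (u : UniversalEnvelopingAlgebra R A)
    {w : UniversalEnvelopingAlgebra R M.DoubleCrossSum}
    (hw : w ∈ LinearMap.range (envelopingMul M)) :
    envelopingInl M u * w ∈ LinearMap.range (envelopingMul M) := by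
  obtain ⟨t, rfl⟩ := hw
  induction t with
  | zero => simp
  | add s t hs ht => rw [map_add, mul_add]; exact add_mem hs ht
  | tmul u' v => exact ⟨(u * u') ⊗ₜ v, by simp only [envelopingMul_tmul, map_mul, mul_assoc]⟩

theorem mul_envelopingInr_mem_range (v : UniversalEnvelopingAlgebra R H)
    {w : UniversalEnvelopingAlgebra R M.DoubleCrossSum}
    (hw : w ∈ LinearMap.range (envelopingMul M)) :
    w * envelopingInr M v ∈ LinearMap.range (envelopingMul M) := by
  obtain ⟨t, rfl⟩ := hw
  induction t with
  | zero => simp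
  | add s t hs ht => rw [map_add, add_mul]; exact add_mem hs ht
  | tmul u v' => exact ⟨u ⊗ₜ (v' * v), by simp only [envelopingMul_tmul, map_mul, mul_assoc]⟩

/-- Induction on `u`, moving `x` to the right past one generator of `U(A)` at a time. -/
theorem envelopingInr_ι_mul_envelopingInl_mem_range (u : UniversalEnvelopingAlgebra R A) (x : H) :
    envelopingInr M (ι R x) * envelopingInl M u ∈ LinearMap.range (envelopingMul M) := by
  have one : ∀ x : H, envelopingInr M (ι R x) ∈ LinearMap.range (envelopingMul M) := fun x =>
    ⟨1 ⊗ₜ ι R x, by rw [envelopingMul_tmul, map_one, one_mul]⟩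
  -- The hypothesis on `u` ranges over all `x`, because passing a generator `a` replaces `x` by `x ◁
  -- a` in one of the terms.
  have key : ∀ v ∈ Algebra.adjoin R (Set.range (ι R : A →ₗ⁅R⁆ _)), ∀ u,
      (∀ x, envelopingInr M (ι R x) * envelopingInl M u ∈ LinearMap.range (envelopingMul M)) →
      ∀ x, envelopingInr M (ι R x) * envelopingInl M (v * u) ∈
        LinearMap.range (envelopingMul M) := by
    intro v hv
    induction hv using Algebra.adjoin_induction with
    | mem v hv =>
      obtain ⟨a, rfl⟩ := hv
      intro u hu x
      have h : envelopingInr M (ι R x) * envelopingInl M (ι R a) =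
          envelopingInl M (ι R a) * envelopingInr M (ι R x) +
            (envelopingInl M (ι R (M.α x a)) + envelopingInr M (ι R (M.β x a))) := by
        simp only [envelopingInl_ι, envelopingInr_ι]
        rw [← map_add, ← inr_lie_inl, ι_lie]
        abel
      rw [map_mul, ← mul_assoc, h, add_mul, add_mul, mul_assoc, ← map_mul]
      refine add_mem (envelopingInl_mul_mem_range M _ (hu x)) (add_mem ?_ (hu _))
      exact ⟨(ι R (M.α x a) * u) ⊗ₜ 1, by rw [envelopingMul_tmul, map_one, mul_one]⟩
    | algebraMap r =>
      intro u hu x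
      rw [← Algebra.smul_def, map_smul, mul_smul_comm]
      exact Submodule.smul_mem _ r (hu x)
    | add v w _ _ hv hw =>
      intro u hu x
      rw [add_mul, map_add, mul_add]
      exact add_mem (hv u hu x) (hw u hu x)
    | mul v w _ _ hv hw =>
      intro u hu
      rw [mul_assoc]
      exact hv _ (hw u hu)
  have := key u (by rw [adjoin_ι]; trivial) 1 (fun x => by rw [map_one, mul_one]; exact one x) x
  rwa [mul_one] at this

/-- The range contains `1` and is stable under left multiplication by generators, hence by the whole
algebra. -/
theorem envelopingMul_surjective : Function.Surjective (envelopingMul M) := by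
  have key : ∀ v ∈ Algebra.adjoin R (Set.range (ι R : M.DoubleCrossSum →ₗ⁅R⁆ _)),
      ∀ w ∈ LinearMap.range (envelopingMul M), v * w ∈ LinearMap.range (envelopingMul M) := by
    intro v hv
    induction hv using Algebra.adjoin_induction with
    | mem v hv =>
      obtain ⟨p, rfl⟩ := hv
      intro w hw
      rw [← inl_add_inr M p, map_add, ← envelopingInl_ι, ← envelopingInr_ι, add_mul]
      refine add_mem (envelopingInl_mul_mem_range M _ hw) ?_
      obtain ⟨t, rfl⟩ := hw
      induction t with
      | zero => simp
      | add s t hs ht => rw [map_add, mul_add]; exact add_mem hs ht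
      | tmul u v =>
        rw [envelopingMul_tmul, ← mul_assoc]
        exact mul_envelopingInr_mem_range M v
          (envelopingInr_ι_mul_envelopingInl_mem_range M u _)
    | algebraMap r =>
      intro w hw
      rw [← Algebra.smul_def]
      exact Submodule.smul_mem _ r hw
    | add v v' _ _ hv hv' =>
      intro w hw
      rw [add_mul]
      exact add_mem (hv w hw) (hv' w hw)
    | mul v v' _ _ hv hv' =>
      intro w hw
      rw [mul_assoc]
      exact hv _ (hv' w hw)
  intro u
  have := key u (by rw [adjoin_ι]; trivial) 1
    ⟨1 ⊗ₜ 1, by rw [envelopingMul_tmul, map_one, map_one, mul_one]⟩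
  rwa [mul_one] at this

end DoubleCrossSum

end LieMatchedPair

/-! ### Bialgebra and Hopf morphisms out of an enveloping algebra -/

namespace UniversalEnvelopingAlgebra

variable {L B : Type*} [LieRing L] [LieAlgebra R L] [Ring B]

/-- An algebra morphism from an enveloping algebra that sends the generators to primitive elements
is a morphism of bialgebras. -/
def bialgHomOfPrimitive [Bialgebra R B] (f : UniversalEnvelopingAlgebra R L →ₐ[R] B)
    (counit_f : ∀ x : L, counit (R := R) (f (ι R x)) = 0)
    (comul_f : ∀ x : L, comul (R := R) (f (ι R x)) = f (ι R x) ⊗ₜ 1 + 1 ⊗ₜ f (ι R x)) :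
    UniversalEnvelopingAlgebra R L →ₐc[R] B :=
  BialgHom.ofAlgHom f
    -- Both coalgebra conditions are equalities of algebra morphisms, so they need checking only on
    -- generators.
    (algHom_ext_ι R fun x => by
      simp only [AlgHom.comp_apply, Bialgebra.counitAlgHom_apply, counit_f, counit_ι])
    (algHom_ext_ι R fun x => by
      simp only [AlgHom.comp_apply, Bialgebra.comulAlgHom_apply, comul_f, comul_ι, map_add,
        Algebra.TensorProduct.map_tmul, map_one])

/-- Both sides reverse products, so agreement on generators propagates. -/
theorem map_antipode [HopfAlgebra R B] (f : UniversalEnvelopingAlgebra R L →ₐ[R] B)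
    (hf : ∀ x : L, HopfAlgebra.antipode R (f (ι R x)) = -f (ι R x))
    (u : UniversalEnvelopingAlgebra R L) :
    f (HopfAlgebra.antipode R u) = HopfAlgebra.antipode R (f u) := by
  induction u using induction_ι with
  | one => simp
  | add u v hu hv => simp only [map_add, hu, hv]
  | smul r u hu => simp only [map_smul, hu]
  | mul u x hu =>
    rw [HopfAlgebra.antipode_mul_antidistrib, map_mul, map_mul,
      HopfAlgebra.antipode_mul_antidistrib, hu, hf, antipode_ι, map_neg]

end UniversalEnvelopingAlgebra

/-! ### The Hopf algebra isomorphism -/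

namespace BialgebraMatchedPair.DoubleCrossProduct

variable {P : BialgebraMatchedPair R (UniversalEnvelopingAlgebra R A)
  (UniversalEnvelopingAlgebra R H)} {M : LieMatchedPair R A H}

/-- The mixed commutation relation of `U(A ⋈ H)`, reproduced in the double cross product; it makes
`ofEnveloping` respect brackets. -/
theorem inr_ι_mul_inl_ι (hM : P.Induces M) (x : H) (a : A) :
    inr P (ι R x) * inl P (ι R a) =
      inl P (ι R a) * inr P (ι R x) + inl P (ι R (M.α x a)) + inr P (ι R (M.β x a)) := by
  change tmul P 1 _ * tmul P _ 1 = tmul P _ 1 * tmul P 1 _ + tmul P _ 1 + tmul P 1 _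
  rw [tmul_mul_tmul, one_sandwich, tmul_one_mul_one_tmul, cross_ι_tmul_ι, (hM x a).1, (hM x a).2,
    add_comm (ι R (M.α x a) ⊗ₜ[R] 1)]
  rfl

/-- The algebra morphism `U(A ⋈ H) → U(A) ⋈ U(H)` with `(a, x) ↦ a ⊗ 1 + 1 ⊗ x`. -/
def ofEnveloping (hM : P.Induces M) :
    UniversalEnvelopingAlgebra R M.DoubleCrossSum →ₐ[R] P.DoubleCrossProduct :=
  UniversalEnvelopingAlgebra.lift R <| lieHomOfCommutator R M.DoubleCrossSum
    ((inl P ∘ₗ (ι R : A →ₗ⁅R⁆ _).toLinearMap).coprod (inr P ∘ₗ (ι R : H →ₗ⁅R⁆ _).toLinearMap))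
    fun p q => by
      obtain ⟨a, x⟩ := p
      obtain ⟨b, y⟩ := q
      have hl : ∀ u v, inl P (u * v) = inl P u * inl P v := fun u v =>
        (tmul_one_mul_tmul_one P u v).symm
      have hr : ∀ u v, inr P (u * v) = inr P u * inr P v := fun u v =>
        (one_tmul_mul_one_tmul P u v).symm
      change inl P (ι R (⁅a, b⁆ + M.α x b - M.α y a)) + inr P (ι R (⁅x, y⁆ + M.β x b - M.β y a)) =
        (inl P (ι R a) + inr P (ι R x)) * (inl P (ι R b) + inr P (ι R y)) -
        (inl P (ι R b) + inr P (ι R y)) * (inl P (ι R a) + inr P (ι R x))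
      simp only [map_add, map_sub, ι_lie, mul_add, add_mul, inr_ι_mul_inl_ι hM, hl, hr]
      abel

theorem ofEnveloping_ι (hM : P.Induces M) (p : M.DoubleCrossSum) :
    ofEnveloping hM (ι R p) = inl P (ι R p.1) + inr P (ι R p.2) :=
  lift_ι_apply R _ p

/-- The inclusion `a ↦ a ⊗ 1` as an algebra morphism. -/
def inlHom : UniversalEnvelopingAlgebra R A →ₐ[R] P.DoubleCrossProduct :=
  AlgHom.ofLinearMap (inl P) rfl fun u v => (tmul_one_mul_tmul_one P u v).symm

/-- The inclusion `x ↦ 1 ⊗ x` as an algebra morphism. -/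
def inrHom : UniversalEnvelopingAlgebra R H →ₐ[R] P.DoubleCrossProduct :=
  AlgHom.ofLinearMap (inr P) rfl fun u v => (one_tmul_mul_one_tmul P u v).symm

-- On each factor the composite is the canonical inclusion, and `(u ⊗ 1)(1 ⊗ v) = u ⊗ v`.
open LieMatchedPair.DoubleCrossSum in
theorem ofEnveloping_envelopingMul (hM : P.Induces M) (t : UniversalEnvelopingAlgebra R A ⊗[R]
    UniversalEnvelopingAlgebra R H) : ofEnveloping hM (envelopingMul M t) = t := by
  have hl : (ofEnveloping hM).comp (envelopingInl M) = inlHom := algHom_ext_ι R fun a => by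
    rw [AlgHom.comp_apply, envelopingInl_ι, ofEnveloping_ι]
    change inl P (ι R a) + inr P (ι R 0) = inl P (ι R a)
    rw [map_zero, map_zero, add_zero]
  have hr : (ofEnveloping hM).comp (envelopingInr M) = inrHom := algHom_ext_ι R fun x => by
    rw [AlgHom.comp_apply, envelopingInr_ι, ofEnveloping_ι]
    change inl P (ι R 0) + inr P (ι R x) = inr P (ι R x)
    rw [map_zero, map_zero, zero_add]
  induction t with
  | zero => exact (congrArg _ (map_zero _)).trans (map_zero _)
  | add s t hs ht => rw [map_add, map_add, hs, ht]; rfl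
  | tmul u v =>
    rw [envelopingMul_tmul, map_mul, ← AlgHom.comp_apply, ← AlgHom.comp_apply, hl, hr]
    exact tmul_one_mul_one_tmul P u v

-- A left inverse of a surjective map is bijective.
open LieMatchedPair.DoubleCrossSum in
theorem ofEnveloping_bijective (hM : P.Induces M) : Function.Bijective (ofEnveloping hM) := by
  refine ⟨?_, fun t => ⟨envelopingMul M t, ofEnveloping_envelopingMul hM t⟩⟩
  intro u v h
  obtain ⟨s, rfl⟩ := envelopingMul_surjective M u
  obtain ⟨t, rfl⟩ := envelopingMul_surjective M v
  rw [ofEnveloping_envelopingMul, ofEnveloping_envelopingMul] at h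
  rw [h]

theorem comul_inl_ι (a : A) : comul (R := R) (inl P (ι R a)) =
    inl P (ι R a) ⊗ₜ 1 + 1 ⊗ₜ inl P (ι R a) := by
  change comul (R := R) (ι R a ⊗ₜ[R] (1 : UniversalEnvelopingAlgebra R H)) = _
  rw [TensorProduct.comul_tmul, comul_ι, Bialgebra.comul_one, Algebra.TensorProduct.one_def,
    TensorProduct.add_tmul, map_add]
  rfl

theorem comul_inr_ι (x : H) : comul (R := R) (inr P (ι R x)) =
    inr P (ι R x) ⊗ₜ 1 + 1 ⊗ₜ inr P (ι R x) := by
  change comul (R := R) ((1 : UniversalEnvelopingAlgebra R A) ⊗ₜ[R] ι R x) = _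
  rw [TensorProduct.comul_tmul, comul_ι, Bialgebra.comul_one, Algebra.TensorProduct.one_def,
    TensorProduct.tmul_add, map_add]
  rfl

theorem antipode_inl (u : UniversalEnvelopingAlgebra R A) :
    HopfAlgebra.antipode R (inl P u) = inl P (HopfAlgebra.antipode R u) := by
  refine (antipodeAux_tmul P u 1).trans ?_
  rw [HopfAlgebra.antipode_one]
  exact one_mul _

theorem antipode_inr (v : UniversalEnvelopingAlgebra R H) :
    HopfAlgebra.antipode R (inr P v) = inr P (HopfAlgebra.antipode R v) := by
  refine (antipodeAux_tmul P 1 v).trans ?_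
  rw [HopfAlgebra.antipode_one]
  exact mul_one _

/-- The isomorphism of bialgebras `U(A ⋈ H) ≃ U(A) ⋈ U(H)`. -/
def envelopingEquiv (hM : P.Induces M) :
    UniversalEnvelopingAlgebra R M.DoubleCrossSum ≃ₐc[R] P.DoubleCrossProduct :=
  BialgEquiv.ofBijective
    (bialgHomOfPrimitive (ofEnveloping hM)
      (fun p => by
        rw [ofEnveloping_ι, map_add]
        change counit (R := R) (tmul P _ 1) + counit (R := R) (tmul P 1 _) = 0
        rw [counit_tmul, counit_tmul, counit_ι, counit_ι, mul_zero, zero_mul, add_zero])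
      (fun p => by
        rw [ofEnveloping_ι, map_add, comul_inl_ι, comul_inr_ι, TensorProduct.add_tmul,
          TensorProduct.tmul_add]
        abel))
    (ofEnveloping_bijective hM)

theorem envelopingEquiv_antipode (hM : P.Induces M)
    (u : UniversalEnvelopingAlgebra R M.DoubleCrossSum) :
    envelopingEquiv hM (HopfAlgebra.antipode R u) =
      HopfAlgebra.antipode R (envelopingEquiv hM u) :=
  map_antipode (ofEnveloping hM) (fun p => by
    rw [ofEnveloping_ι, map_add, antipode_inl, antipode_inr, antipode_ι, antipode_ι, map_neg,
      map_neg, neg_add]) u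

end BialgebraMatchedPair.DoubleCrossProduct

end Isomorphism

end

theorem theorem3p2 {k A H : Type*} [Field k] [LieRing A] [LieAlgebra k A] [LieRing H]
    [LieAlgebra k H]
    (P : BialgebraMatchedPair k (UniversalEnvelopingAlgebra k A) (UniversalEnvelopingAlgebra k H))
    (hα : ∀ (x : H) (a : A), ∃ b : A,
      P.α (UniversalEnvelopingAlgebra.ι k x ⊗ₜ UniversalEnvelopingAlgebra.ι k a) =
        UniversalEnvelopingAlgebra.ι k b)
    (hβ : ∀ (x : H) (a : A), ∃ y : H,
      P.β (UniversalEnvelopingAlgebra.ι k x ⊗ₜ UniversalEnvelopingAlgebra.ι k a) =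
        UniversalEnvelopingAlgebra.ι k y) :
    (∃! M : LieMatchedPair k A H, P.Induces M) ∧
    ∀ M : LieMatchedPair k A H, P.Induces M →
      ∃ e : UniversalEnvelopingAlgebra k M.DoubleCrossSum ≃ₐc[k] P.DoubleCrossProduct,
        ∀ u, e (HopfAlgebra.antipode k u) = HopfAlgebra.antipode k (e u) :=
  -- The field enters only here: it makes `A` and `H` free modules, so that `ι` is injective on
  -- both.
  ⟨P.existsUnique_induces UniversalEnvelopingAlgebra.ι_injective
      UniversalEnvelopingAlgebra.ι_injective hα hβ,
    fun _ hM => ⟨BialgebraMatchedPair.DoubleCrossProduct.envelopingEquiv hM,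
      BialgebraMatchedPair.DoubleCrossProduct.envelopingEquiv_antipode hM⟩⟩
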